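/- For $d\ge 1$ and $n\ge 2$ the Hamming graph $H(d,n)$ has vertex set $[n]^d$, $[n]=\{0,\dots,n-1\}$, two vertices being adjacent if and only if they differ in exactly one coordinate. A regular embedding of a graph $K$ is a 2-cell embedding of $K$ in a compact connected surface without boundary such that the automorphism group of the resulting map $\mathcal M$ acts regularly on its flags; it is nonorientable if the surface is. (Combinatorially, a map is given by its finite set of flags and three fixed-point-free involutions $r_0,r_1,r_2$ on it that generate a transitive group, where $r_0$ changes only the vertex, $r_1$ only the edge and $r_2$ only the face of a flag, and $r_0r_2=r_2r_0$ has no fixed point. The vertices, edges and faces are the orbits of $\langle r_1,r_2\rangle$, $\langle r_0,r_2\rangle$ and $\langle r_0,r_1\rangle$, the vertices and edges forming the graph $K$. Automorphisms and isomorphisms are the bijections between flags that commute with the $r_i$. The surface is orientable if and only if the flags can be 2-coloured so that each $r_i$ reverses the colours.) An admissible triple $(\lambda,\rho,\tau)$ of a regular map consists of the automorphisms taking some flag $x$ to $r_0x$, $r_1x$ and $r_2x$ respectively; they are regarded as automorphisms of $K$. Let permutations act on the right. Write $(\delta_0,\delta_1)\pi$, with $\delta_0,\delta_1\in S_6$ and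 $\pi\in S_2$, for the automorphism of $H(2,6)$ that applies $\delta_i$ to the $i$-th coordinate ($i=0,1$) and then moves the $i$-th coordinate to place $i^\pi$. For $\sigma_0,\sigma_1\in S_6$, say that a regular embedding of $H(2,6)$ corresponds to $(\sigma_0,\sigma_1)$ if it has an admissible triple $(\lambda,\rho,\tau)$ such that for some automorphism $\phi$ of $H(2,6)$ $$\phi^{-1}\tau\phi=((2\ 5)(3\ 4),\,(1\ 5)(2\ 4))\,\mathrm{id},\qquad \phi^{-1}\rho\tau\phi=(\mathrm{id},\,(1\ 2\ 3\ 4\ 5))\,(0\ 1),\qquad \phi^{-1}\lambda\tau\phi=(\sigma_0,\sigma_1)\,\mathrm{id}.$$ **Lemma 3.4.** There is no nonorientable regular embedding of $H(d,6)$ for any $d\ge 3$, and there are, up to isomorphism, at most two nonorientable regular embeddings of $H(2,6)$. More precisely, every nonorientable regular embedding of $H(2,6)$ corresponds to $\sigma_0=(0\ 1)(2\ 5)$, $\sigma_1=(1\ 2)(4\ 5)$ or to $\sigma_0=(0\ 1)(3\ 4)$, $\sigma_1=(1\ 4)(2\ 5)$, and any two nonorientable regular embeddings of $H(2,6)$ that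 correspond to the same pair $(\sigma_0,\sigma_1)$ are isomorphic. -/

import Mathlib

universe u

/-- The Hamming graph `H(d,n)`: vertex set `[n]^d`, two vertices being adjacent when they differ
in exactly one coordinate. -/
def hammingGraph (d n : ℕ) : SimpleGraph (Fin d → Fin n) where
  Adj a b := ∃! i, a i ≠ b i
  symm := ⟨by
    intro a b h
    simpa only [ne_comm] using h⟩
  loopless := ⟨by
    rintro a ⟨i, hi, -⟩
    exact hi rfl⟩

/-- A 2-cell embedding of a simple graph `K` in a compact connected surface without boundary,
given by its flags (the triangles of the barycentric subdivision of the embedding).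
Each flag `x` is incident with one vertex, one edge and one face, and has three distinct
neighbours: `r0 x` (same edge and face, other end of the edge), `r1 x` (same vertex and face,
other edge) and `r2 x` (same vertex and edge, other side of the edge).
The vertices, edges and faces are the orbits of `⟨r1, r2⟩`, `⟨r0, r2⟩` and `⟨r0, r1⟩`, and the
graph formed by these vertices and edges is identified with `K` by the labelling `vert`. -/
structure GraphMap {V : Type*} (K : SimpleGraph V) where
  Flag : Type u
  nonempty : Nonempty Flag
  /-- compactness of the surface -/
  finite : Finite Flag
  r0 : Equiv.Perm Flag
  r1 : Equiv.Perm Flag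
  r2 : Equiv.Perm Flag
  r0_invol : ∀ x, r0 (r0 x) = x
  r1_invol : ∀ x, r1 (r1 x) = x
  r2_invol : ∀ x, r2 (r2 x) = x
  /-- `r0`, `r1`, `r2` have no fixed points: the surface has no boundary -/
  r0_ne : ∀ x, r0 x ≠ x
  r1_ne : ∀ x, r1 x ≠ x
  r2_ne : ∀ x, r2 x ≠ x
  /-- every edge carries exactly four flags -/
  r0_r2_comm : ∀ x, r0 (r2 x) = r2 (r0 x)
  r0_r2_ne : ∀ x, r0 (r2 x) ≠ x
  /-- connectedness of the surface -/
  connected : ∀ x y, ∃ g ∈ Subgroup.closure {r0, r1, r2}, g x = y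
  /-- the vertex of `K` with which a flag is incident -/
  vert : Flag → V
  /-- the vertices of the map correspond bijectively to those of `K` -/
  vert_surjective : Function.Surjective vert
  vert_eq_iff : ∀ x y, vert x = vert y ↔ ∃ g ∈ Subgroup.closure {r1, r2}, g x = y
  /-- the edges of the map correspond bijectively to those of `K` -/
  adj_iff : ∀ a b, K.Adj a b ↔ ∃ x, vert x = a ∧ vert (r0 x) = b
  edge_eq : ∀ x y, s(vert x, vert (r0 x)) = s(vert y, vert (r0 y)) →
    ∃ g ∈ Subgroup.closure {r0, r2}, g x = y

namespace GraphMap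

variable {V : Type*} {K : SimpleGraph V}

/-- Automorphisms of a map: permutations of the flags preserving the three adjacency relations
(and hence the relations of having a vertex, an edge or a face in common). -/
def IsAut (M : GraphMap.{u} K) (a : Equiv.Perm M.Flag) : Prop :=
  ∀ x, a (M.r0 x) = M.r0 (a x) ∧ a (M.r1 x) = M.r1 (a x) ∧ a (M.r2 x) = M.r2 (a x)

/-- The map is regular: its automorphism group acts regularly on the flags. -/
def IsRegular (M : GraphMap.{u} K) : Prop :=
  ∀ x y, ∃! a : Equiv.Perm M.Flag, M.IsAut a ∧ a x = y

/-- The underlying surface is orientable: the flags (triangles of the barycentric subdivision)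
can be given one of two senses each, so that adjacent flags have opposite senses. -/
def IsOrientable (M : GraphMap.{u} K) : Prop :=
  ∃ o : M.Flag → Bool, ∀ x, o (M.r0 x) = !o x ∧ o (M.r1 x) = !o x ∧ o (M.r2 x) = !o x

/-- `M` is a nonorientable regular embedding of `K`. -/
def IsNonorientableRegular (M : GraphMap.{u} K) : Prop :=
  M.IsRegular ∧ ¬ M.IsOrientable

/-- Isomorphism of maps with underlying graph `K`: a bijection of the flags preserving all
adjacencies, together with the graph isomorphism `ψ` that it induces. -/
def IsIsomorphic (M N : GraphMap.{u} K) : Prop :=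
  ∃ (e : M.Flag ≃ N.Flag) (ψ : K ≃g K), ∀ x,
    e (M.r0 x) = N.r0 (e x) ∧ e (M.r1 x) = N.r1 (e x) ∧ e (M.r2 x) = N.r2 (e x) ∧
      N.vert (e x) = ψ (M.vert x)

/-- Some automorphism of `M` takes the flag `x` to the flag `y` and induces the automorphism `g`
of the graph `K`. -/
def Induces (M : GraphMap.{u} K) (x y : M.Flag) (g : K ≃g K) : Prop :=
  ∃ a : Equiv.Perm M.Flag, M.IsAut a ∧ a x = y ∧ ∀ z, M.vert (a z) = g (M.vert z)

/-- `(l, r, t)` is an admissible triple `(λ, ρ, τ)` of `M`, seen as graph automorphisms: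
for some flag `x = (v, e, f)`, `λ` fixes `e` and `f`, `ρ` fixes `v` and `f`, `τ` fixes `v` and `e`,
and none of them fixes `x`. -/
def IsAdmissibleTriple (M : GraphMap.{u} K) (l r t : K ≃g K) : Prop :=
  ∃ x, M.Induces x (M.r0 x) l ∧ M.Induces x (M.r1 x) r ∧ M.Induces x (M.r2 x) t

end GraphMap

/-- The element `(δ₀, …, δ_{d-1}) π` of the wreath product `S_n ≀ S_d`, acting on the vertices of
`H(d,n)`: first apply `δ i` to the `i`-th coordinate, for each `i`, and then move the
`i`-th coordinate to place `π i`. -/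
def wreathAct {d n : ℕ} (δ : Fin d → Equiv.Perm (Fin n)) (π : Equiv.Perm (Fin d))
    (v : Fin d → Fin n) : Fin d → Fin n :=
  fun j => δ (π.symm j) (v (π.symm j))

/-- `M` has an admissible triple `(λ, ρ, τ)` such that, for some automorphism `φ` of `H(2,6)`,
`φ⁻¹ τ φ = ((2 5)(3 4), (1 5)(2 4)) id`, `φ⁻¹ ρτ φ = (id, (1 2 3 4 5)) (0 1)` and
`φ⁻¹ λτ φ = (σ₀, σ₁) id`. Here permutations act on the right, so `ρτ` means `ρ` first, and
`φ⁻¹ g φ = h` means that `h (φ v) = φ (g v)` for all vertices `v`. -/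
def GraphMap.CorrespondsTo (M : GraphMap.{u} (hammingGraph 2 6))
    (σ₀ σ₁ : Equiv.Perm (Fin 6)) : Prop :=
  ∃ l r t : hammingGraph 2 6 ≃g hammingGraph 2 6, M.IsAdmissibleTriple l r t ∧
    ∃ φ : hammingGraph 2 6 ≃g hammingGraph 2 6, ∀ v,
      φ (t v) = wreathAct ![Equiv.swap 2 5 * Equiv.swap 3 4, Equiv.swap 1 5 * Equiv.swap 2 4]
        1 (φ v) ∧
      φ (t (r v)) = wreathAct ![1, c[1, 2, 3, 4, 5]] (Equiv.swap 0 1) (φ v) ∧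
      φ (t (l v)) = wreathAct ![σ₀, σ₁] 1 (φ v)

/-!
A regular map is determined by the action of its automorphisms on the vertices, and the
automorphisms of `H(d,6)` form the wreath product `S_6 ≀ S_d` (`exists_wreathAut_eq`). At a flag `x`
the regular map has an automorphism `R` that rotates the `5d` edges at the vertex of `x`, and `R`
permutes the `d` directions in a cycle; so `R ^ d` acts coordinatewise, with a `5`-cycle in each
coordinate (`GraphMap.IsRegular.exists_rotation`). None of the arguments needs the surface to be
nonorientable: they apply to all regular embeddings.

For `d ≥ 3`, a reflection at a vertex cannot fix every direction, so an automorphism fixing a vertex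
and all directions has order dividing `5` (`GraphMap.IsRegular.pow_five_eq_one`). Let `p`, `q` be
the values at the ends of an edge of the coordinate in which the ends differ. The powers `R ^ d` at
the two ends fix all the other coordinates of these ends, and in this coordinate they act as
`5`-cycles `α`, `β` fixing `p` and `q` respectively. Some product `t` of powers of `α` and `β` swaps
`p` and `q`. Then `t ^ 2` has order dividing `5` and two fixed points, so it is the identity, while
`t` itself has no fixed point. Thus `t` is a product of three transpositions and odd, but `5`-cycles
are even (`GraphMap.IsRegular.not_three_le`).

For `d = 2`, coordinates can be chosen so that the rotation and the reflection at `x` are the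
standard ones (`GraphMap.IsRegular.exists_isFrame`). The half-turn about the edge of `x` is then a
pair of involutions commuting with the reflection, which leaves `36` pairs
(`GraphMap.IsFrame.exists_flip`). For all but two of them a word in the half-turn and the rotation
fixes `(0,0)` but breaks the cyclic order of its neighbours, which an automorphism of the map cannot
do (`exists_breaksOrder`, `GraphMap.IsFrame.not_breaksOrder`). Finally, maps with conjugate
admissible triples are isomorphic (`GraphMap.IsRegular.isIsomorphic_of_conj`); the base vertices
match because the rotation has only one fixed vertex.
-/

/-! ### Automorphisms of a map and their action on the vertices -/

namespace GraphMap

section General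

variable {V : Type*} {K : SimpleGraph V} (M : GraphMap.{u} K)

/-- The automorphism group of a map, as a group of permutations of its flags. -/
def autGroup : Subgroup (Equiv.Perm M.Flag) where
  carrier := {a | M.IsAut a}
  mul_mem' := by
    intro a b ha hb x
    simp [(ha _).1, (ha _).2.1, (ha _).2.2, (hb _).1, (hb _).2.1, (hb _).2.2]
  one_mem' := by intro x; simp
  inv_mem' := by
    intro a ha x
    simp [Equiv.symm_apply_eq, (ha _).1, (ha _).2.1, (ha _).2.2]

/-- The rotation of the flags about their vertices: `r2` first, then `r1`. -/
def rot : Equiv.Perm M.Flag := M.r1 * M.r2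

/-- The far end of the `k`-th edge at the vertex of `x`, counted from the edge of `x` on. -/
def nbr (x : M.Flag) (k : ℤ) : V := M.vert (M.r0 ((M.rot ^ k) x))

variable {M}

section
variable (a : M.autGroup) (x : M.Flag)
lemma aut_r0 : a.1 (M.r0 x) = M.r0 (a.1 x) := (a.2 x).1
lemma aut_r1 : a.1 (M.r1 x) = M.r1 (a.1 x) := (a.2 x).2.1
lemma aut_r2 : a.1 (M.r2 x) = M.r2 (a.1 x) := (a.2 x).2.2

lemma aut_rot : a.1 (M.rot x) = M.rot (a.1 x) := by
  simp [rot, aut_r1, aut_r2]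

lemma aut_rot_zpow (k : ℤ) : a.1 ((M.rot ^ k) x) = (M.rot ^ k) (a.1 x) := by
  have h : Commute a.1 M.rot := by ext x; exact aut_rot a x
  exact congrArg (· x) (h.zpow_right k).eq
end

lemma IsRegular.exists_aut (hM : M.IsRegular) (x y : M.Flag) : ∃ a : M.autGroup, a.1 x = y := by
  obtain ⟨a, ⟨ha, hx⟩, -⟩ := hM x y
  exact ⟨⟨a, ha⟩, hx⟩

lemma IsRegular.aut_ext (hM : M.IsRegular) {a b : M.autGroup} {x : M.Flag} (h : a.1 x = b.1 x) :
    a = b :=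
  Subtype.ext ((hM x (b.1 x)).unique ⟨a.2, h⟩ ⟨b.2, rfl⟩)

lemma r1_eq_rot_inv (x : M.Flag) : M.r1 x = M.r2 ((M.rot ^ (-1 : ℤ)) x) := by
  have : M.r1 x = M.r2 (M.rot⁻¹ x) := by
    rw [← M.r2.injective.eq_iff, M.r2_invol, ← M.rot.injective.eq_iff]
    simp [rot, M.r2_invol, M.r1_invol]
  simpa using this

lemma rot_r2 (x : M.Flag) : M.rot (M.r2 x) = M.r1 x := by simp [rot, M.r2_invol]

lemma rot_zpow_r2 (x : M.Flag) (k : ℤ) :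
    (M.rot ^ k) (M.r2 x) = M.r2 ((M.rot ^ (-k)) x) := by
  have h2 : M.r2⁻¹ = M.r2 := by
    ext x
    rw [Equiv.Perm.inv_eq_iff_eq, M.r2_invol]
  have h : M.r2 * M.rot * M.r2⁻¹ = M.rot⁻¹ := by
    ext x
    have := r1_eq_rot_inv x
    rw [h2]
    simp only [Equiv.Perm.coe_mul, Function.comp_apply, rot_r2, this, M.r2_invol]
    simp
  have h3 : M.r2 * M.rot ^ (-k) * M.r2⁻¹ = M.rot ^ k := by
    rw [← conj_zpow, h, inv_zpow, zpow_neg, inv_inv]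
  rw [← h3, h2]
  simp [M.r2_invol]

lemma r1_rot_zpow (x : M.Flag) (k : ℤ) :
    M.r1 ((M.rot ^ k) x) = M.r2 ((M.rot ^ (k - 1)) x) := by
  rw [r1_eq_rot_inv, sub_eq_neg_add, zpow_add, Equiv.Perm.mul_apply]

lemma vert_r1 (x : M.Flag) : M.vert (M.r1 x) = M.vert x :=
  (M.vert_eq_iff _ _).2 ⟨M.r1, Subgroup.subset_closure (by simp), M.r1_invol x⟩

lemma vert_r2 (x : M.Flag) : M.vert (M.r2 x) = M.vert x :=
  (M.vert_eq_iff _ _).2 ⟨M.r2, Subgroup.subset_closure (by simp), M.r2_invol x⟩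

lemma vert_r0_r2 (x : M.Flag) : M.vert (M.r0 (M.r2 x)) = M.vert (M.r0 x) := by
  rw [M.r0_r2_comm, vert_r2]

lemma vert_rot_zpow (x : M.Flag) (k : ℤ) : M.vert ((M.rot ^ k) x) = M.vert x := by
  refine (M.vert_eq_iff _ _).2 ⟨(M.rot ^ k)⁻¹, inv_mem (zpow_mem (mul_mem ?_ ?_) _), by simp⟩ <;>
  exact Subgroup.subset_closure (by simp)

/-- A set of flags that is closed under some involutions is closed under the group that they
generate. -/
lemma mem_of_mem_closure {F : Set (Equiv.Perm M.Flag)} {S : Set M.Flag} {h : Equiv.Perm M.Flag}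
    (hF : ∀ f ∈ F, ∀ y, f (f y) = y) (hS : ∀ f ∈ F, ∀ y ∈ S, f y ∈ S)
    (hh : h ∈ Subgroup.closure F) : ∀ {y}, y ∈ S → h y ∈ S := by
  suffices H : ∀ y, y ∈ S ↔ h y ∈ S from fun {y} => (H y).1
  induction hh using Subgroup.closure_induction with
  | mem f hf => exact fun y => ⟨hS f hf y, fun h => hF f hf y ▸ hS f hf _ h⟩
  | one => simp
  | mul a b _ _ iha ihb => intro y; rw [ihb, iha]; rfl
  | inv a _ ih => intro y; rw [ih (a⁻¹ y)]; simp

/-- The flags at a vertex are the rotated copies of any one of them and their mirror images. -/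
lemma eq_rot_zpow_of_vert_eq {x y : M.Flag} (h : M.vert x = M.vert y) :
    ∃ k : ℤ, y = (M.rot ^ k) x ∨ y = M.r2 ((M.rot ^ k) x) := by
  obtain ⟨g, hg, rfl⟩ := (M.vert_eq_iff _ _).1 h
  refine mem_of_mem_closure (S := {y | ∃ k : ℤ, y = (M.rot ^ k) x ∨ y = M.r2 ((M.rot ^ k) x)})
    ?_ ?_ hg ⟨0, by simp⟩
  · rintro f (rfl | rfl)
    · exact M.r1_invol
    · exact M.r2_invol
  rintro f (rfl | rfl)
  · rintro _ ⟨k, rfl | rfl⟩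
    · exact ⟨k - 1, Or.inr (r1_rot_zpow x k)⟩
    · refine ⟨1 + k, Or.inl ?_⟩
      rw [← rot_r2, M.r2_invol, zpow_add, zpow_one, Equiv.Perm.mul_apply]
  · rintro _ ⟨k, rfl | rfl⟩
    · exact ⟨k, Or.inr rfl⟩
    · exact ⟨k, Or.inl (M.r2_invol _)⟩

lemma adj_vert_r0 (x : M.Flag) : K.Adj (M.vert x) (M.vert (M.r0 x)) :=
  (M.adj_iff _ _).2 ⟨x, rfl, rfl⟩

lemma vert_r0_ne (x : M.Flag) : M.vert (M.r0 x) ≠ M.vert x := (adj_vert_r0 x).ne'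

/-- A dart of the graph carries exactly two flags. -/
lemma eq_or_eq_r2 {x y : M.Flag} (h : M.vert y = M.vert x)
    (h0 : M.vert (M.r0 y) = M.vert (M.r0 x)) : y = x ∨ y = M.r2 x := by
  obtain ⟨g, hg, rfl⟩ := M.edge_eq x y (by rw [h, h0])
  have := mem_of_mem_closure
    (S := {z | z = x ∨ z = M.r2 x ∨ z = M.r0 x ∨ z = M.r0 (M.r2 x)}) ?_ ?_ hg (y := x) (by simp)
  · rcases this with h1 | h1 | h1 | h1
    · exact Or.inl h1
    · exact Or.inr h1
    · rw [h1] at h; exact absurd h (vert_r0_ne x)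
    · rw [h1, vert_r0_r2] at h; exact absurd h (vert_r0_ne x)
  · rintro f (rfl | rfl)
    · exact M.r0_invol
    · exact M.r2_invol
  · rintro f (rfl | rfl)
    · rintro z (rfl | rfl | rfl | rfl) <;> simp [M.r0_invol]
    · rintro z (rfl | rfl | rfl | rfl) <;> simp [M.r2_invol, M.r0_r2_comm]

lemma exists_nbr_eq {x : M.Flag} {w : V} (h : K.Adj (M.vert x) w) : ∃ k : ℤ, w = M.nbr x k := by
  obtain ⟨y, hy, rfl⟩ := (M.adj_iff _ _).1 h
  obtain ⟨k, rfl | rfl⟩ := eq_rot_zpow_of_vert_eq hy.symm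
  · exact ⟨k, rfl⟩
  · exact ⟨k, vert_r0_r2 _⟩

lemma vert_aut_congr (a : M.autGroup) {x y : M.Flag} (h : M.vert x = M.vert y) :
    M.vert (a.1 x) = M.vert (a.1 y) := by
  obtain ⟨k, rfl | rfl⟩ := eq_rot_zpow_of_vert_eq h
  · rw [aut_rot_zpow, vert_rot_zpow]
  · rw [aut_r2, vert_r2, aut_rot_zpow, vert_rot_zpow]

/-- The action of an automorphism of a map on the vertices. -/
noncomputable def vertFun (a : M.autGroup) (v : V) : V :=
  M.vert (a.1 (Function.surjInv M.vert_surjective v))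

lemma vertFun_vert (a : M.autGroup) (x : M.Flag) : vertFun a (M.vert x) = M.vert (a.1 x) :=
  vert_aut_congr a (Function.surjInv_eq M.vert_surjective _)

lemma vertFun_mul (a b : M.autGroup) (v : V) : vertFun (a * b) v = vertFun a (vertFun b v) := by
  obtain ⟨x, rfl⟩ := M.vert_surjective v
  simp [vertFun_vert]

lemma vertFun_one (v : V) : vertFun (1 : M.autGroup) v = v := by
  obtain ⟨x, rfl⟩ := M.vert_surjective v
  simp [vertFun_vert]

lemma vertFun_adj (a : M.autGroup) {v w : V} (h : K.Adj v w) :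
    K.Adj (vertFun a v) (vertFun a w) := by
  obtain ⟨x, rfl, rfl⟩ := (M.adj_iff _ _).1 h
  rw [vertFun_vert, vertFun_vert, aut_r0]
  exact adj_vert_r0 _

/-- The automorphisms of a map act on the embedded graph. -/
noncomputable def vertAut : M.autGroup →* (K ≃g K) where
  toFun a :=
    { toFun := vertFun a
      invFun := vertFun a⁻¹
      left_inv v := by rw [← vertFun_mul, inv_mul_cancel, vertFun_one]
      right_inv v := by rw [← vertFun_mul, mul_inv_cancel, vertFun_one]
      map_rel_iff' := by
        intro v w
        refine ⟨fun h => ?_, vertFun_adj a⟩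
        have := vertFun_adj a⁻¹ h
        simpa only [Equiv.coe_fn_mk, ← vertFun_mul, inv_mul_cancel, vertFun_one] using this }
  map_one' := by ext v; exact vertFun_one v
  map_mul' a b := by ext v; exact vertFun_mul a b v

lemma vertAut_vert (a : M.autGroup) (x : M.Flag) : vertAut a (M.vert x) = M.vert (a.1 x) :=
  vertFun_vert a x

lemma vertAut_nbr (a : M.autGroup) (x : M.Flag) (k : ℤ) :
    vertAut a (M.nbr x k) = M.nbr (a.1 x) k := by
  rw [nbr, nbr, vertAut_vert, aut_r0, aut_rot_zpow]

lemma nbr_zero (x : M.Flag) : M.nbr x 0 = M.vert (M.r0 x) := by simp [nbr]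

lemma nbr_rot_zpow (x : M.Flag) (k l : ℤ) : M.nbr ((M.rot ^ l) x) k = M.nbr x (k + l) := by
  rw [nbr, nbr, zpow_add, Equiv.Perm.mul_apply]

lemma nbr_r2 (x : M.Flag) (k : ℤ) : M.nbr (M.r2 x) k = M.nbr x (-k) := by
  rw [nbr, nbr, rot_zpow_r2, vert_r0_r2]

lemma induces_iff {x y : M.Flag} {g : K ≃g K} :
    M.Induces x y g ↔ ∃ a : M.autGroup, a.1 x = y ∧ vertAut a = g := by
  constructor
  · rintro ⟨a, ha, hx, hg⟩
    refine ⟨⟨a, ha⟩, hx, ?_⟩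
    ext v
    obtain ⟨z, rfl⟩ := M.vert_surjective v
    rw [vertAut_vert, hg]
  · rintro ⟨a, hx, rfl⟩
    exact ⟨a.1, a.2, hx, fun z => (vertAut_vert a z).symm⟩

/-- In a map in which the vertices have more than two neighbours, no rotation about a vertex agrees
with a reflection at a flag. -/
lemma IsRegular.rot_zpow_ne_r2 (hM : M.IsRegular) (hs : ∀ x, M.rot (M.rot x) ≠ x) (x : M.Flag)
    (m : ℤ) : (M.rot ^ m) x ≠ M.r2 x := by
  intro h
  -- By transitivity the rotation by `m` is the reflection `r2` at every flag, so it commutes with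
  -- the rotation and inverts it.
  have hall : ∀ y, (M.rot ^ m) y = M.r2 y := by
    intro y
    obtain ⟨b, rfl⟩ := hM.exists_aut x y
    rw [← aut_rot_zpow, h, aut_r2]
  have h1 : M.r2 (M.rot x) = M.r2 ((M.rot ^ (-1 : ℤ)) x) := by
    rw [← hall, ← r1_eq_rot_inv, ← rot_r2, ← hall, ← Equiv.Perm.mul_apply, ← Equiv.Perm.mul_apply,
      ← zpow_add_one, ← zpow_one_add, add_comm]
  have h2 := M.r2.injective h1
  apply hs x
  rw [h2]
  simp

lemma IsRegular.vertAut_injective (hM : M.IsRegular) (hs : ∀ x, M.rot (M.rot x) ≠ x) :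
    Function.Injective (vertAut : M.autGroup →* (K ≃g K)) := by
  rw [injective_iff_map_eq_one]
  intro a ha
  have fix : ∀ y, a.1 y = y ∨ a.1 y = M.r2 y := by
    intro y
    apply eq_or_eq_r2
    · rw [← vertAut_vert, ha]; rfl
    · rw [← aut_r0, ← vertAut_vert, ha]; rfl
  obtain ⟨x⟩ := M.nonempty
  rcases fix x with h | h
  · exact hM.aut_ext (x := x) h
  · exfalso
    have h1 : a.1 (M.rot x) = M.r2 ((M.rot ^ (-1 : ℤ)) x) := by
      rw [aut_rot, h, rot_r2, r1_eq_rot_inv]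
    rcases fix (M.rot x) with h2 | h2
    · apply hM.rot_zpow_ne_r2 hs ((M.rot ^ (-1 : ℤ)) x) 2
      rw [← h1, h2, ← Equiv.Perm.mul_apply, ← zpow_add]
      norm_num
    · have h3 := M.r2.injective (h1.symm.trans h2)
      apply hs x
      rw [← h3]
      simp

/-- Two regular maps whose admissible triples are conjugate under an automorphism of the graph that
matches the base vertices are isomorphic. -/
lemma IsRegular.isIsomorphic_of_conj {N : GraphMap.{u} K} (hM : M.IsRegular) (hN : N.IsRegular)
    (hsM : ∀ x, M.rot (M.rot x) ≠ x) (hsN : ∀ x, N.rot (N.rot x) ≠ x) (ψ : K ≃g K)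
    {x : M.Flag} {x' : N.Flag} (hx : ψ (M.vert x) = N.vert x')
    {a₀ a₁ a₂ : M.autGroup} {b₀ b₁ b₂ : N.autGroup}
    (ha₀ : a₀.1 x = M.r0 x) (ha₁ : a₁.1 x = M.r1 x) (ha₂ : a₂.1 x = M.r2 x)
    (hb₀ : b₀.1 x' = N.r0 x') (hb₁ : b₁.1 x' = N.r1 x') (hb₂ : b₂.1 x' = N.r2 x')
    (h₀ : ψ * vertAut a₀ = vertAut b₀ * ψ) (h₁ : ψ * vertAut a₁ = vertAut b₁ * ψ)
    (h₂ : ψ * vertAut a₂ = vertAut b₂ * ψ) : M.IsIsomorphic N := by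
  have hmul : ∀ {a a' : M.autGroup} {b b' : N.autGroup}, ψ * vertAut a = vertAut b * ψ →
      ψ * vertAut a' = vertAut b' * ψ → ψ * vertAut (a * a') = vertAut (b * b') * ψ := by
    intro a a' b b' h h'
    rw [map_mul, map_mul, ← mul_assoc, h, mul_assoc, h', mul_assoc]
  have hex : ∀ y, ∃ (a : M.autGroup) (b : N.autGroup), a.1 x = y ∧
      ψ * vertAut a = vertAut b * ψ := by
    intro y
    obtain ⟨g, hg, rfl⟩ := M.connected x y
    refine mem_of_mem_closure (S := {y | ∃ (a : M.autGroup) (b : N.autGroup), a.1 x = y ∧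
      ψ * vertAut a = vertAut b * ψ}) ?_ ?_ hg ⟨1, 1, rfl, by simp⟩
    · rintro f (rfl | rfl | rfl)
      · exact M.r0_invol
      · exact M.r1_invol
      · exact M.r2_invol
    · rintro f (rfl | rfl | rfl) _ ⟨a, b, rfl, h⟩
      · exact ⟨a * a₀, b * b₀, by rw [← aut_r0, ← ha₀]; rfl, hmul h h₀⟩
      · exact ⟨a * a₁, b * b₁, by rw [← aut_r1, ← ha₁]; rfl, hmul h h₁⟩
      · exact ⟨a * a₂, b * b₂, by rw [← aut_r2, ← ha₂]; rfl, hmul h h₂⟩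
  choose A B hA hAB using hex
  -- the flag `a x` goes to `b x'` for any automorphisms `a` and `b` that `ψ` matches
  have key : ∀ {a : M.autGroup} {b : N.autGroup}, ψ * vertAut a = vertAut b * ψ →
      (B (a.1 x)).1 x' = b.1 x' := by
    intro a b h
    have h1 : A (a.1 x) = a := hM.aut_ext (hA _)
    have h2 := hAB (a.1 x)
    rw [h1, h] at h2
    rw [hN.vertAut_injective hsN (mul_right_cancel h2)]
  have e0 : ∀ y, (B (M.r0 y)).1 x' = N.r0 ((B y).1 x') := by
    intro y
    have := key (hmul (hAB y) h₀)
    rw [← aut_r0, ← hb₀]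
    refine Eq.trans ?_ this
    change _ = (B ((A y).1 (a₀.1 x))).1 x'
    rw [ha₀, aut_r0, hA]
  have e1 : ∀ y, (B (M.r1 y)).1 x' = N.r1 ((B y).1 x') := by
    intro y
    have := key (hmul (hAB y) h₁)
    rw [← aut_r1, ← hb₁]
    refine Eq.trans ?_ this
    change _ = (B ((A y).1 (a₁.1 x))).1 x'
    rw [ha₁, aut_r1, hA]
  have e2 : ∀ y, (B (M.r2 y)).1 x' = N.r2 ((B y).1 x') := by
    intro y
    have := key (hmul (hAB y) h₂)
    rw [← aut_r2, ← hb₂]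
    refine Eq.trans ?_ this
    change _ = (B ((A y).1 (a₂.1 x))).1 x'
    rw [ha₂, aut_r2, hA]
  have hbij : Function.Bijective fun y => (B y).1 x' := by
    constructor
    · intro y y' h
      have hB : B y = B y' := hN.aut_ext h
      have h1 := hAB y
      rw [hB, ← hAB y'] at h1
      have hAA := hM.vertAut_injective hsM (mul_left_cancel h1)
      rw [← hA y, ← hA y', hAA]
    · intro z
      obtain ⟨g, hg, rfl⟩ := N.connected x' z
      refine mem_of_mem_closure (S := Set.range fun y => (B y).1 x') ?_ ?_ hg ⟨x, ?_⟩
      · rintro f (rfl | rfl | rfl)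
        · exact N.r0_invol
        · exact N.r1_invol
        · exact N.r2_invol
      · rintro f (rfl | rfl | rfl) _ ⟨y, rfl⟩
        · exact ⟨_, e0 y⟩
        · exact ⟨_, e1 y⟩
        · exact ⟨_, e2 y⟩
      · simpa using key (a := 1) (b := 1) (by simp)
  refine ⟨Equiv.ofBijective _ hbij, ψ, fun y => ⟨e0 y, e1 y, e2 y, ?_⟩⟩
  change N.vert ((B y).1 x') = _
  rw [← vertAut_vert, ← hx, ← hA y, ← vertAut_vert, hA]
  exact (DFunLike.congr_fun (hAB y) (M.vert x)).symm

end General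

end GraphMap

/-! ### Automorphisms of Hamming graphs -/

section Hamming

variable {d n : ℕ}

lemma hamming_adj {v w : Fin d → Fin n} :
    (hammingGraph d n).Adj v w ↔ ∃ i, v i ≠ w i ∧ ∀ j, j ≠ i → v j = w j := by
  change (∃! i, v i ≠ w i) ↔ _
  constructor
  · rintro ⟨i, hi, hu⟩
    exact ⟨i, hi, fun j hj => by_contra fun h => hj (hu j h)⟩
  · rintro ⟨i, hi, hu⟩
    exact ⟨i, hi, fun j hj => by_contra fun h => hj (hu j h)⟩

lemma adj_update {v : Fin d → Fin n} {i : Fin d} {z : Fin n} (h : z ≠ v i) :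
    (hammingGraph d n).Adj v (Function.update v i z) :=
  hamming_adj.2 ⟨i, by simpa using h.symm, fun j hj => by simp [hj]⟩

lemma exists_eq_update {v w : Fin d → Fin n} (h : (hammingGraph d n).Adj v w) :
    ∃ i z, z ≠ v i ∧ w = Function.update v i z := by
  obtain ⟨i, hi, hu⟩ := hamming_adj.1 h
  refine ⟨i, w i, hi.symm, ?_⟩
  ext1 j
  by_cases hj : j = i
  · subst hj; simp
  · simp [hj, hu j hj]

/-- The wreath product elements are automorphisms of the Hamming graph. -/
def wreathAut (δ : Fin d → Equiv.Perm (Fin n)) (π : Equiv.Perm (Fin d)) :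
    hammingGraph d n ≃g hammingGraph d n where
  toFun := wreathAct δ π
  invFun v i := (δ i).symm (v (π i))
  left_inv v := by ext1 i; simp [wreathAct]
  right_inv v := by ext1 i; simp [wreathAct]
  map_rel_iff' := by
    intro v w
    rw [hamming_adj, hamming_adj]
    constructor
    · rintro ⟨i, hi, hu⟩
      refine ⟨π.symm i, fun h => hi (by simp [wreathAct, h]), fun j hj => ?_⟩
      have := hu (π j) (fun h => hj (by simp [← h]))
      simpa [wreathAct] using this
    · rintro ⟨i, hi, hu⟩
      refine ⟨π i, by simpa [wreathAct] using hi, fun j hj => ?_⟩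
      have := hu (π.symm j) (fun h => hj (by simp [← h]))
      simp [wreathAct, this]

lemma wreathAut_apply (δ : Fin d → Equiv.Perm (Fin n)) (π : Equiv.Perm (Fin d)) (v : Fin d → Fin n)
    (i : Fin d) : wreathAut δ π v (π i) = δ i (v i) := by
  simp [wreathAut, wreathAct]

/-- The `i`-th coordinates of `v` and `w` are the only ones that may differ. -/
def AgreeOff (i : Fin d) (v w : Fin d → Fin n) : Prop := ∀ j, j ≠ i → v j = w j

lemma AgreeOff.symm {i : Fin d} {v w : Fin d → Fin n} (h : AgreeOff i v w) : AgreeOff i w v :=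
  fun j hj => (h j hj).symm

lemma AgreeOff.trans {i : Fin d} {u v w : Fin d → Fin n} (h : AgreeOff i u v)
    (h' : AgreeOff i v w) : AgreeOff i u w :=
  fun j hj => (h j hj).trans (h' j hj)

lemma agreeOff_update (v : Fin d → Fin n) (i : Fin d) (z : Fin n) :
    AgreeOff i v (Function.update v i z) := fun j hj => by simp [hj]

/-- Two edges at a vertex that lie in a triangle have the same direction. -/
lemma agreeOff_of_adj {i : Fin d} {u v w : Fin d → Fin n} (huv : (hammingGraph d n).Adj u v)
    (huw : (hammingGraph d n).Adj u w) (hvw : (hammingGraph d n).Adj v w ∨ v = w)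
    (hi : AgreeOff i u v) : AgreeOff i u w := by
  rcases hvw with hvw | rfl
  · obtain ⟨a, ha, hau⟩ := hamming_adj.1 huv
    obtain ⟨b, hb, hbu⟩ := hamming_adj.1 huw
    obtain ⟨c, hc, hcu⟩ := hamming_adj.1 hvw
    have hai : a = i := by_contra fun h => ha (hi a h)
    subst hai
    by_contra h
    have hba : b ≠ a := by
      rintro rfl
      exact h hbu
    have h1 : a = c := by
      by_contra hac
      exact ha ((hbu a hba.symm).trans (hcu a hac).symm)
    have h2 : b = c := by
      by_contra hbc
      exact hb ((hau b hba).trans (hcu b hbc))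
    exact hba (h2.trans h1.symm)
  · exact hi

lemma adj_of_agreeOff {i : Fin d} {v w : Fin d → Fin n} (h : AgreeOff i v w) (hne : v ≠ w) :
    (hammingGraph d n).Adj v w := by
  refine hamming_adj.2 ⟨i, fun hi => hne ?_, h⟩
  ext1 j
  by_cases hj : j = i
  · rw [hj, hi]
  · exact h j hj

/-- Opposite sides of a chordless quadrangle have the same direction. -/
lemma agreeOff_opposite {i : Fin d} {a b c e : Fin d → Fin n} (hab : (hammingGraph d n).Adj a b)
    (hae : (hammingGraph d n).Adj a e) (hbc : (hammingGraph d n).Adj b c)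
    (hec : (hammingGraph d n).Adj e c) (hac : a ≠ c) (hbe : ¬ (hammingGraph d n).Adj b e)
    (hbe' : b ≠ e) (hi : AgreeOff i a b) : AgreeOff i e c := by
  obtain ⟨i', hi1, hi2⟩ := hamming_adj.1 hab
  obtain rfl : i' = i := by_contra fun h => hi1 (hi i' h)
  obtain ⟨j, hj1, hj2⟩ := hamming_adj.1 hae
  have hij : j ≠ i' := by
    rintro rfl
    exact hbe (adj_of_agreeOff (AgreeOff.trans (AgreeOff.symm hi2) hj2) hbe')
  obtain ⟨k, hk1, hk2⟩ := hamming_adj.1 hbc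
  obtain ⟨l, hl1, hl2⟩ := hamming_adj.1 hec
  by_cases hl : l = i'
  · exact hl ▸ hl2
  exfalso
  have h1 : b i' ≠ c i' := by
    rw [← hl2 i' (Ne.symm hl), ← hj2 i' hij.symm]
    exact hi1.symm
  obtain rfl : i' = k := by_contra fun h => h1 (hk2 i' h)
  have h2 : e j ≠ c j := by
    rw [← hk2 j hij, ← hi2 j hij]
    exact hj1.symm
  obtain rfl : j = l := by_contra fun h => h2 (hl2 j h)
  apply hac
  ext1 m
  by_cases hm : m = i'
  · subst hm
    rw [hj2 m hij.symm, hl2 m hij.symm]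
  · rw [hi2 m hm, hk2 m hm]

/-- A property that is kept when one coordinate is changed holds everywhere once it holds
somewhere: the Hamming graph is connected. -/
lemma forall_of_update {P : (Fin d → Fin n) → Prop} {v₀ : Fin d → Fin n} (h0 : P v₀)
    (h : ∀ v i z, P v → P (Function.update v i z)) (v : Fin d → Fin n) : P v := by
  have : ∀ s : Finset (Fin d), P (fun j => if j ∈ s then v j else v₀ j) := by
    intro s
    induction s using Finset.induction_on with
    | empty => simpa using h0
    | insert i s _ ih =>
      convert h _ i (v i) ih using 1
      ext1 j
      by_cases hj : j = i
      · subst hj; simp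
      · simp [hj]
  simpa using this Finset.univ

section Automorphism

variable (g : hammingGraph d n ≃g hammingGraph d n)

/-- An automorphism takes the edges of one direction to edges of one direction. -/
lemma exists_direction (hn : 2 ≤ n) (i : Fin d) :
    ∃ j, ∀ v z, AgreeOff j (g v) (g (Function.update v i z)) := by
  let v₀ : Fin d → Fin n := fun _ => ⟨0, by omega⟩
  -- the image of one edge of direction `i` determines `j`
  have e0 : (hammingGraph d n).Adj v₀ (Function.update v₀ i ⟨1, by omega⟩) :=
    adj_update (by simp [v₀])
  obtain ⟨j, -, hj⟩ := hamming_adj.1 (g.map_rel_iff.2 e0)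
  refine ⟨j, fun v => ?_⟩
  -- all edges at one vertex that lie in one direction are treated alike
  have star : ∀ (v : Fin d → Fin n) (z z' : Fin n), z ≠ v i →
      AgreeOff j (g v) (g (Function.update v i z)) →
      AgreeOff j (g v) (g (Function.update v i z')) := by
    intro v z z' hz h
    by_cases hz' : z' = v i
    · rw [hz', Function.update_eq_self]
      exact fun _ _ => rfl
    refine agreeOff_of_adj (g.map_rel_iff.2 (adj_update hz)) (g.map_rel_iff.2 (adj_update hz')) ?_ h
    by_cases hzz : z = z'
    · right; rw [hzz]
    · left
      rw [g.map_rel_iff]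
      refine adj_of_agreeOff (i := i)
        ((agreeOff_update v i z).symm.trans (agreeOff_update v i z')) fun h => hzz ?_
      simpa using congrFun h i
  refine forall_of_update (P := fun v => ∀ z, AgreeOff j (g v) (g (Function.update v i z)))
    (v₀ := v₀) (fun z => star v₀ _ z (by simp [v₀]) hj) ?_ v
  intro v k y ih z
  by_cases hk : k = i
  · subst hk
    rw [Function.update_idem]
    exact (ih y).symm.trans (ih z)
  by_cases hy : y = v k
  · rw [hy, Function.update_eq_self]; exact ih z
  by_cases hz : z = v i
  · have : Function.update (Function.update v k y) i z = Function.update v k y := by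
      rw [hz, Function.update_eq_self_iff, Function.update_of_ne (Ne.symm hk)]
    rw [this]
    exact fun _ _ => rfl
  have hcomm : Function.update (Function.update v k y) i z
      = Function.update (Function.update v i z) k y := Function.update_comm hk _ _ _
  have h4 : (hammingGraph d n).Adj (Function.update v k y)
      (Function.update (Function.update v k y) i z) :=
    adj_update (by rwa [Function.update_of_ne (Ne.symm hk)])
  refine agreeOff_opposite (g.map_rel_iff.2 (adj_update hz)) (g.map_rel_iff.2 (adj_update hy))
    (g.map_rel_iff.2 (hcomm ▸ adj_update (by rwa [Function.update_of_ne hk])))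
    (g.map_rel_iff.2 h4) ?_ ?_ ?_ (ih z)
  · refine fun h => hy ?_
    have := congrFun (g.injective h) k
    rw [hcomm, Function.update_self] at this
    exact this.symm
  · rw [g.map_rel_iff, hamming_adj]
    rintro ⟨m, hm, hmu⟩
    by_cases hmi : m = i
    · have := hmu k (hmi ▸ hk)
      simp only [Function.update_self, Function.update_of_ne hk] at this
      exact hy this.symm
    · have := hmu i (Ne.symm hmi)
      simp only [Function.update_self, Function.update_of_ne (Ne.symm hk)] at this
      exact hz this
  · refine fun h => hz ?_
    have := congrFun (g.injective h) i
    simpa only [Function.update_self, Function.update_of_ne (Ne.symm hk)] using this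

/-- Every automorphism of a Hamming graph belongs to the wreath product `S_n ≀ S_d`. -/
theorem exists_wreathAut_eq (hn : 2 ≤ n) : ∃ δ π, g = wreathAut δ π := by
  choose p hp using exists_direction g hn
  have hpinj : Function.Injective p := by
    intro i j hij
    by_contra hne
    -- otherwise two edges of a chordless quadrangle would have images of the same direction
    let v : Fin d → Fin n := fun _ => ⟨0, by omega⟩
    have hz : (⟨1, by omega⟩ : Fin n) ≠ ⟨0, by omega⟩ := by simp
    have h := (hp i v ⟨1, by omega⟩).symm.trans (hij ▸ hp j v ⟨1, by omega⟩)
    have hvij : Function.update v i (⟨1, by omega⟩ : Fin n) ≠ Function.update v j ⟨1, by omega⟩ := by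
      intro h
      have := congrFun h i
      rw [Function.update_self, Function.update_of_ne hne] at this
      exact hz this
    have hadj := g.map_rel_iff.1 (adj_of_agreeOff h (fun h => hvij (g.injective h)))
    obtain ⟨m, -, hm⟩ := hamming_adj.1 hadj
    by_cases hmi : m = i
    · have := hm j (hmi ▸ Ne.symm hne)
      rw [Function.update_self, Function.update_of_ne (Ne.symm hne)] at this
      exact hz this.symm
    · have := hm i (Ne.symm hmi)
      rw [Function.update_self, Function.update_of_ne hne] at this
      exact hz this
  have hpbij : Function.Bijective p := Finite.injective_iff_bijective.1 hpinj
  let π := Equiv.ofBijective p hpbij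
  let v₀ : Fin d → Fin n := fun _ => ⟨0, by omega⟩
  let f : Fin d → Fin n → Fin n := fun i z => g (Function.update v₀ i z) (p i)
  have hf : ∀ v i, g v (p i) = f i (v i) := by
    intro v i
    refine forall_of_update (P := fun v => g v (p i) = f i (v i)) (v₀ := v₀) ?_ ?_ v
    · simp only [f, Function.update_eq_self]
    · intro v k z ih
      by_cases hk : k = i
      · subst hk
        rw [Function.update_self]
        -- change the other coordinates one at a time, starting from `update v₀ k z`
        have := forall_of_update
          (P := fun w => g (Function.update w k z) (p k) = f k z) (v₀ := v₀) rfl ?_ v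
        · exact this
        · intro w m y hw
          by_cases hm : m = k
          · subst hm; rw [Function.update_idem]; exact hw
          · rw [Function.update_comm hm, ← hw]
            exact ((hp m (Function.update w k z) y) (p k) (fun h => hm (hpinj h).symm)).symm
      · rw [Function.update_of_ne (Ne.symm hk), ← ih]
        exact ((hp k v z) (p i) (fun h => hk (hpinj h).symm)).symm
  have hfinj : ∀ i, Function.Injective (f i) := by
    intro i a b hab
    have h1 : g (Function.update v₀ i a) = g (Function.update v₀ i b) := by
      ext1 j
      obtain ⟨k, rfl⟩ := hpbij.2 j
      rw [hf, hf]
      by_cases hk : k = i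
      · subst hk; simpa using hab
      · simp [hk]
    simpa using congrFun (g.injective h1) i
  let δ : Fin d → Equiv.Perm (Fin n) := fun i =>
    Equiv.ofBijective (f i) (Finite.injective_iff_bijective.1 (hfinj i))
  refine ⟨δ, π, ?_⟩
  ext1 v
  ext1 j
  obtain ⟨k, rfl⟩ := hpbij.2 j
  rw [hf]
  exact (wreathAut_apply δ π v k).symm

/-- An automorphism of a Hamming graph is determined by its effect on a vertex and its
neighbours. -/
lemma aut_eq_of_nbrs (hn : 2 ≤ n) {g h : hammingGraph d n ≃g hammingGraph d n}
    {v : Fin d → Fin n} (hv : g v = h v)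
    (hw : ∀ w, (hammingGraph d n).Adj v w → g w = h w) : g = h := by
  suffices H : h⁻¹ * g = 1 by rw [inv_mul_eq_one] at H; exact H.symm
  obtain ⟨δ, π, hk⟩ := exists_wreathAut_eq (h⁻¹ * g) hn
  have hv' : wreathAut δ π v = v := by
    rw [← hk, RelIso.mul_apply, hv]; exact h.symm_apply_apply v
  have hw' : ∀ i z, wreathAut δ π (Function.update v i z) = Function.update v i z := by
    intro i z
    by_cases hz : z = v i
    · rw [hz, Function.update_eq_self, hv']
    · rw [← hk, RelIso.mul_apply, hw _ (adj_update hz)]; exact h.symm_apply_apply _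
  have hπ : ∀ i, π i = i := by
    intro i
    by_contra hne
    have : Nontrivial (Fin n) := Fin.nontrivial_iff_two_le.2 hn
    obtain ⟨z, hz⟩ := exists_ne (v i)
    have h1 := congrFun (hw' i z) (π i)
    have h2 := congrFun hv' (π i)
    rw [wreathAut_apply] at h1 h2
    rw [Function.update_self, Function.update_of_ne hne, ← h2] at h1
    exact hz ((δ i).injective h1)
  rw [hk]
  ext1 w
  ext1 i
  have h1 := congrFun (hw' i (w i)) (π i)
  have h2 := wreathAut_apply δ π w i
  rw [wreathAut_apply, hπ, Function.update_self] at h1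
  rw [hπ] at h2
  rw [h2, h1]
  rfl

end Automorphism

lemma wreathAut_mul (δ δ' : Fin d → Equiv.Perm (Fin n)) (π π' : Equiv.Perm (Fin d)) :
    wreathAut δ π * wreathAut δ' π' = wreathAut (fun i => δ (π' i) * δ' i) (π * π') := by
  ext1 v
  ext1 j
  obtain ⟨k, rfl⟩ := (π * π').surjective j
  rw [wreathAut_apply, RelIso.mul_apply, Equiv.Perm.mul_apply, wreathAut_apply, wreathAut_apply]
  rfl

lemma exists_wreathAut_pow (δ : Fin d → Equiv.Perm (Fin n)) (π : Equiv.Perm (Fin d)) (k : ℕ) :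
    ∃ δ', wreathAut δ π ^ k = wreathAut δ' (π ^ k) := by
  induction k with
  | zero => exact ⟨fun _ => 1, rfl⟩
  | succ k ih =>
    obtain ⟨δ', h⟩ := ih
    exact ⟨_, by rw [pow_succ, h, wreathAut_mul, pow_succ]⟩

/-- The base group of the wreath product: one permutation for each coordinate. -/
def coordAut : (Fin d → Equiv.Perm (Fin n)) →* (hammingGraph d n ≃g hammingGraph d n) where
  toFun δ := wreathAut δ 1
  map_one' := rfl
  map_mul' δ δ' := by rw [wreathAut_mul]; rfl

lemma coordAut_apply (δ : Fin d → Equiv.Perm (Fin n)) (v : Fin d → Fin n) (i : Fin d) :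
    coordAut δ v i = δ i (v i) :=
  wreathAut_apply δ 1 v i

lemma coordAut_injective [NeZero n] :
    Function.Injective (coordAut : (Fin d → Equiv.Perm (Fin n)) →* _) := by
  intro δ δ' h
  ext1 i
  ext1 z
  rw [← coordAut_apply δ (fun _ => z), h, coordAut_apply]

end Hamming

/-! ### Rotations of a regular embedding of `H(d,6)` -/

/-- The powers of a permutation that fix a point are determined by the size of its cycle. -/
lemma zpow_apply_eq_self_iff {X : Type*} [Finite X] (π : Equiv.Perm X) (q : X) (k : ℤ) :
    (π ^ k) q = q ↔ (({z | ∃ l : ℤ, (π ^ l) q = z}.ncard : ℕ) : ℤ) ∣ k := by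
  have horb : {z | ∃ l : ℤ, (π ^ l) q = z} = MulAction.orbit (Subgroup.zpowers π) q := by
    ext z
    constructor
    · rintro ⟨l, hl⟩
      exact ⟨⟨_, l, rfl⟩, hl⟩
    · rintro ⟨⟨_, l, rfl⟩, hl⟩
      exact ⟨l, hl⟩
  have := Fintype.ofFinite (MulAction.orbit (Subgroup.zpowers π) q)
  rw [horb, ← Nat.card_coe_set_eq, Nat.card_eq_fintype_card, ← MulAction.minimalPeriod_eq_card,
    ← MulAction.zpow_smul_eq_iff_minimalPeriod_dvd, Equiv.Perm.smul_def]

/-- A permutation of six points that fixes one point and is transitive on the others has order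
dividing five. -/
lemma perm_pow_five {α : Equiv.Perm (Fin 6)} {p q : Fin 6} (hq : q ≠ p) (hp : α p = p)
    (h : ∀ z, z ≠ p → ∃ k : ℤ, (α ^ k) q = z) : α ^ 5 = 1 := by
  have horb : {z | ∃ l : ℤ, (α ^ l) q = z} = {p}ᶜ := by
    ext z
    constructor
    · rintro ⟨k, rfl⟩ hz
      exact hq ((α ^ k).injective (hz.trans (Function.IsFixedPt.perm_zpow (e := α) hp k).symm))
    · exact fun hz => h z hz
  have h5 : (α ^ (5 : ℤ)) q = q := by
    rw [zpow_apply_eq_self_iff, horb, Set.ncard_compl]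
    simp
  ext1 z
  by_cases hz : z = p
  · rw [hz]
    exact Function.IsFixedPt.perm_pow (e := α) hp 5
  · obtain ⟨k, rfl⟩ := h z hz
    rw [← zpow_natCast, ← Equiv.Perm.mul_apply, ← zpow_add, add_comm, zpow_add,
      Equiv.Perm.mul_apply]
    exact congrArg _ h5

namespace GraphMap

section Rotation

variable {d : ℕ} {M : GraphMap.{u} (hammingGraph d 6)}

/-- The coordinate in which the two ends of the edge of a flag differ. -/
noncomputable def dir (x : M.Flag) : Fin d := (hamming_adj.1 (adj_vert_r0 x)).choose

lemma vert_dir_ne (x : M.Flag) : M.vert x (dir x) ≠ M.vert (M.r0 x) (dir x) :=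
  (hamming_adj.1 (adj_vert_r0 x)).choose_spec.1

lemma vert_eq_of_ne_dir (x : M.Flag) {j : Fin d} (hj : j ≠ dir x) :
    M.vert x j = M.vert (M.r0 x) j :=
  (hamming_adj.1 (adj_vert_r0 x)).choose_spec.2 j hj

lemma dir_eq {x : M.Flag} {i : Fin d} (h : M.vert x i ≠ M.vert (M.r0 x) i) : dir x = i := by
  by_contra hi
  exact h (vert_eq_of_ne_dir x (Ne.symm hi))

lemma dir_r2 (x : M.Flag) : dir (M.r2 x) = dir x :=
  dir_eq (by rw [vert_r2, vert_r0_r2]; exact vert_dir_ne x)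

lemma dir_r0 (x : M.Flag) : dir (M.r0 x) = dir x :=
  dir_eq (by rw [M.r0_invol]; exact (vert_dir_ne x).symm)

lemma dir_aut {a : M.autGroup} {δ π} (ha : vertAut a = wreathAut δ π) (x : M.Flag) :
    dir (a.1 x) = π (dir x) := by
  apply dir_eq
  rw [← aut_r0, ← vertAut_vert, ← vertAut_vert, ha, wreathAut_apply, wreathAut_apply]
  exact fun h => vert_dir_ne x ((δ _).injective h)

lemma nbr_eq_of_ne_dir (x : M.Flag) (k : ℤ) {j : Fin d} (hj : j ≠ dir ((M.rot ^ k) x)) :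
    M.nbr x k j = M.vert x j := by
  have := vert_eq_of_ne_dir _ hj
  rw [vert_rot_zpow] at this
  exact this.symm

lemma nbr_dir_ne (x : M.Flag) (k : ℤ) :
    M.nbr x k (dir ((M.rot ^ k) x)) ≠ M.vert x (dir ((M.rot ^ k) x)) := by
  have := vert_dir_ne ((M.rot ^ k) x)
  rw [vert_rot_zpow] at this
  exact this.symm

lemma exists_nbr_eq_update (x : M.Flag) {i : Fin d} {z : Fin 6} (hz : z ≠ M.vert x i) :
    ∃ k : ℤ, M.nbr x k = Function.update (M.vert x) i z ∧ dir ((M.rot ^ k) x) = i := by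
  obtain ⟨k, hk⟩ := exists_nbr_eq (adj_update hz)
  refine ⟨k, hk.symm, dir_eq ?_⟩
  rw [vert_rot_zpow]
  change _ ≠ M.nbr x k i
  rw [← hk, Function.update_self]
  exact hz.symm

lemma rot_rot_ne (x : M.Flag) : M.rot (M.rot x) ≠ x := by
  intro h
  have h2 : (M.rot ^ (2 : ℤ)) x = x := by simpa [zpow_ofNat, pow_two] using h
  -- then there are at most two neighbours
  have hk : ∀ k : ℤ, M.nbr x k = M.nbr x 0 ∨ M.nbr x k = M.nbr x 1 := by
    intro k
    have per : ∀ l m : ℤ, M.nbr x (l + 2 * m) = M.nbr x l := by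
      intro l m
      have : (M.rot ^ (2 * m)) x = x := by
        rw [zpow_mul]
        exact Function.IsFixedPt.perm_zpow (e := M.rot ^ (2 : ℤ)) h2 m
      rw [← nbr_rot_zpow, this]
    rcases Int.emod_two_eq_zero_or_one k with h | h
    · left; rw [← per 0 (k / 2)]; congr 1; omega
    · right; rw [← per 1 (k / 2)]; congr 1; omega
  have hz : ∀ z, z = M.vert x (dir x) ∨ z = M.nbr x 0 (dir x) ∨ z = M.nbr x 1 (dir x) := by
    intro z
    by_cases hz : z = M.vert x (dir x)
    · exact Or.inl hz
    · obtain ⟨k, hk1, -⟩ := exists_nbr_eq_update x hz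
      have : z = M.nbr x k (dir x) := by rw [hk1, Function.update_self]
      rcases hk k with h | h <;> rw [h] at this <;> simp [this]
  have : (Finset.univ : Finset (Fin 6)) ⊆ {M.vert x (dir x), M.nbr x 0 (dir x), M.nbr x 1 (dir x)} :=
    fun z _ => by simpa using hz z
  have := (Finset.card_le_card this).trans Finset.card_le_three
  simp at this

/-- The rotation about a vertex of a regular embedding of `H(d,6)`: it permutes the directions in a
cycle of length `d`, so its `d`-th power acts coordinatewise. -/
lemma IsRegular.exists_rotation (hM : M.IsRegular) (x : M.Flag) :
    ∃ (R : M.autGroup) (α : Fin d → Equiv.Perm (Fin 6)), R.1 x = M.rot x ∧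
      vertAut (R ^ d) = coordAut α ∧ (∀ j, α j (M.vert x j) = M.vert x j) ∧
      (∀ z, z ≠ M.vert x (dir x) → ∃ k : ℤ, (α (dir x) ^ k) (M.nbr x 0 (dir x)) = z) ∧
      (M.rot ^ (5 * d)) x = x ∧
      ∀ k : ℤ, dir ((M.rot ^ k) x) = dir x ↔ (d : ℤ) ∣ k := by
  obtain ⟨R, hR⟩ := hM.exists_aut x (M.rot x)
  obtain ⟨δ, π, hδ⟩ := exists_wreathAut_eq (vertAut R) (by norm_num)
  -- the rotation moves the flags at `vert x` along, and hence the directions by `π`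
  have hRk : ∀ k l : ℤ, (R ^ k).1 ((M.rot ^ l) x) = (M.rot ^ (k + l)) x := by
    intro k l
    have h : ∀ k : ℕ, (R ^ k).1 x = (M.rot ^ k) x := by
      intro k
      induction k with
      | zero => simp
      | succ k ih =>
        rw [pow_succ, pow_succ', Equiv.Perm.mul_apply, ← ih]
        change (R ^ k).1 (R.1 x) = _
        rw [hR, aut_rot]
    have h' : (R ^ k).1 x = (M.rot ^ k) x := by
      obtain ⟨m, rfl | rfl⟩ := k.eq_nat_or_neg
      · exact_mod_cast h m
      · rw [zpow_neg, zpow_neg, zpow_natCast, zpow_natCast]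
        change (R ^ m).1⁻¹ x = _
        rw [Equiv.Perm.inv_eq_iff_eq]
        rw [← zpow_natCast M.rot, ← zpow_neg, aut_rot_zpow, h m, zpow_neg, zpow_natCast]
        simp
    rw [aut_rot_zpow, h', ← Equiv.Perm.mul_apply, ← zpow_add, add_comm]
  have hdir1 : ∀ k : ℤ, dir ((M.rot ^ (1 + k)) x) = π (dir ((M.rot ^ k) x)) := by
    intro k
    rw [← hRk 1 k, zpow_one, dir_aut hδ]
  have hdir : ∀ k : ℤ, dir ((M.rot ^ k) x) = (π ^ k) (dir x) := by
    intro k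
    induction k using Int.induction_on with
    | zero => simp
    | succ k ih => rw [add_comm, hdir1, ih, zpow_one_add]; rfl
    | pred k ih =>
      apply π.injective
      rw [← hdir1, add_sub_cancel, ih, ← Equiv.Perm.mul_apply, ← zpow_one_add, add_sub_cancel]
  have hsurj : ∀ j, ∃ k : ℤ, (π ^ k) (dir x) = j := by
    intro j
    obtain ⟨z, hz⟩ := exists_ne (M.vert x j)
    obtain ⟨k, -, hk⟩ := exists_nbr_eq_update x hz
    exact ⟨k, by rw [← hdir, hk]⟩
  have hper : ∀ k : ℤ, (π ^ k) (dir x) = dir x ↔ (d : ℤ) ∣ k := by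
    intro k
    rw [zpow_apply_eq_self_iff, Set.eq_univ_of_forall (s := {z | ∃ l : ℤ, (π ^ l) (dir x) = z}) hsurj,
      Set.ncard_univ, Nat.card_fin]
  have hπd : π ^ d = 1 := by
    ext1 j
    obtain ⟨k, rfl⟩ := hsurj j
    rw [← zpow_natCast, ← Equiv.Perm.mul_apply, ← zpow_add, add_comm, zpow_add,
      Equiv.Perm.mul_apply, (hper d).2 dvd_rfl]
    rfl
  obtain ⟨α, hα⟩ := exists_wreathAut_pow δ π d
  have hα' : vertAut (R ^ d) = coordAut α := by
    rw [map_pow, hδ, hα, hπd]; rfl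
  have hfix : ∀ j, α j (M.vert x j) = M.vert x j := by
    intro j
    rw [← coordAut_apply, ← hα', vertAut_vert]
    have := hRk d 0
    rw [zpow_natCast, zpow_zero] at this
    change (R ^ d).1 x = _ at this
    rw [this, vert_rot_zpow]
  have htrans : ∀ z, z ≠ M.vert x (dir x) → ∃ k : ℤ, (α (dir x) ^ k) (M.nbr x 0 (dir x)) = z := by
    intro z hz
    obtain ⟨k, hk, hk'⟩ := exists_nbr_eq_update x hz
    rw [hdir, hper] at hk'
    obtain ⟨m, rfl⟩ := hk'
    refine ⟨m, ?_⟩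
    have h1 : vertAut ((R ^ d) ^ m) = coordAut (α ^ m) := by
      rw [map_zpow, hα', map_zpow]
    have h2 := coordAut_apply (α ^ m) (M.nbr x 0) (dir x)
    rw [← h1, vertAut_nbr, ← zpow_natCast, ← zpow_mul] at h2
    have h3 := hRk (d * m) 0
    rw [zpow_zero] at h3
    change (R ^ (d * m : ℤ)).1 x = _ at h3
    rw [h3, nbr_rot_zpow, zero_add, add_zero, hk, Function.update_self] at h2
    exact h2.symm
  refine ⟨R, α, hR, hα', hfix, htrans, ?_, fun k => by rw [hdir, hper]⟩
  -- `R ^ (5 * d)` fixes a vertex and one of its neighbours, and a rotation is not a reflection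
  have hpow : vertAut (R ^ (5 * d)) = coordAut (α ^ 5) := by
    rw [mul_comm, pow_mul, map_pow, hα', map_pow]
  have h5 : α (dir x) ^ 5 = 1 := perm_pow_five (by simpa using nbr_dir_ne x 0) (hfix _) htrans
  have hR5 := hRk (5 * d) 0
  rw [zpow_zero, add_zero] at hR5
  change (R ^ (5 * d : ℤ)).1 x = _ at hR5
  have hR5' : (R ^ (5 * d)).1 x = (M.rot ^ (5 * d : ℤ)) x := by exact_mod_cast hR5
  have hn : M.nbr ((M.rot ^ (5 * d : ℤ)) x) 0 = M.nbr x 0 := by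
    rw [← hR5', ← vertAut_nbr, hpow]
    ext1 j
    rw [coordAut_apply]
    by_cases hj : j = dir x
    · subst hj
      rw [Pi.pow_apply, h5]; rfl
    · rw [nbr_eq_of_ne_dir x 0 (by simpa using hj)]
      exact Function.IsFixedPt.perm_pow (e := α j) (hfix j) 5
  rw [nbr_zero, nbr_zero] at hn
  rcases eq_or_eq_r2 (vert_rot_zpow x (5 * d)) hn with h | h
  · exact_mod_cast h
  · exact absurd h (hM.rot_zpow_ne_r2 rot_rot_ne x _)

/-- For `d ≥ 3`, an automorphism that fixes a vertex and every direction is a rotation about that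
vertex by a multiple of `d` steps; a reflection reverses the cyclic order of the directions. -/
lemma IsRegular.pow_five_eq_one (hM : M.IsRegular) (hd : 3 ≤ d) {a : M.autGroup}
    {δ : Fin d → Equiv.Perm (Fin 6)} (ha : vertAut a = coordAut δ) {w : Fin d → Fin 6}
    (hw : ∀ j, δ j (w j) = w j) : a ^ 5 = 1 := by
  obtain ⟨x, rfl⟩ := M.vert_surjective w
  obtain ⟨R, α, hR, -, -, -, hper, hdir⟩ := hM.exists_rotation x
  have hdx : ∀ y, dir (a.1 y) = dir y := fun y => dir_aut ha y
  have hv : M.vert x = M.vert (a.1 x) := by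
    rw [← vertAut_vert, ha]
    ext1 j
    rw [coordAut_apply, hw]
  obtain ⟨k, hk | hk⟩ := eq_rot_zpow_of_vert_eq hv
  · obtain ⟨m, rfl⟩ := (hdir k).1 (by rw [← hk, hdx])
    apply hM.aut_ext (x := x)
    have h1 : ∀ n : ℕ, (a ^ n).1 x = (M.rot ^ (d * m * n)) x := by
      intro n
      induction n with
      | zero => simp
      | succ n ih =>
        rw [pow_succ']
        change a.1 ((a ^ n).1 x) = _
        rw [ih, aut_rot_zpow, hk, ← Equiv.Perm.mul_apply, ← zpow_add]
        congr 2
        push_cast; ring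
    rw [h1, show (d * m * (5 : ℕ) : ℤ) = (5 * d : ℕ) * m by push_cast; ring, zpow_mul, zpow_natCast]
    exact Function.IsFixedPt.perm_zpow (e := M.rot ^ (5 * d)) hper m
  · exfalso
    have h0 : (d : ℤ) ∣ k := (hdir k).1 (by rw [← dir_r2, ← hk, hdx])
    obtain ⟨-, -, -, -, -, -, -, hdir'⟩ := hM.exists_rotation (M.rot x)
    have h1 : a.1 (M.rot x) = M.r2 ((M.rot ^ (k - 2)) (M.rot x)) := by
      rw [aut_rot, hk, rot_r2, r1_rot_zpow, ← Equiv.Perm.mul_apply (M.rot ^ (k - 2)),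
        ← zpow_add_one]
      congr 3; ring
    have h2 : (d : ℤ) ∣ k - 2 := (hdir' _).1 (by rw [← dir_r2, ← h1, hdx])
    have h3 : (d : ℤ) ∣ 2 := by simpa using dvd_sub h0 h2
    have := Int.le_of_dvd (by norm_num) h3
    omega

/-- A permutation of six points that swaps two of them is a product of three disjoint
transpositions, and hence odd, if its order divides ten, and divides five when it has a fixed
point. -/
lemma sign_eq_neg_one {t : Equiv.Perm (Fin 6)} {p q : Fin 6} (hpq : p ≠ q) (htp : t p = q)
    (htq : t q = p) (h10 : t ^ 10 = 1) (hfix : ∀ z, t z = z → t ^ 5 = 1) :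
    Equiv.Perm.sign t = -1 := by
  have h2 : t ^ 2 = 1 := by
    -- the fixed points of `t ^ 2`, of which there are at least two, number one modulo five
    have h5 : (t ^ 2) ^ 5 ^ 1 = 1 := by rw [← pow_mul]; exact h10
    have := Fact.mk Nat.prime_five
    have hc := Equiv.Perm.card_compl_support_modEq h5
    have hsub : {p, q} ⊆ (t ^ 2).supportᶜ := by
      intro z hz
      rw [Finset.mem_compl, Equiv.Perm.notMem_support, pow_two, Equiv.Perm.mul_apply]
      rcases Finset.mem_insert.1 hz with rfl | hz
      · rw [htp, htq]
      · rw [Finset.mem_singleton.1 hz, htq, htp]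
    have h2 := Finset.card_le_card hsub
    rw [Finset.card_pair hpq] at h2
    have h6 := Finset.card_compl_add_card (t ^ 2).support
    rw [Fintype.card_fin] at h6 hc
    rw [← Equiv.Perm.card_support_eq_zero]
    have hc' : (t ^ 2).supportᶜ.card % 5 = 1 := hc
    omega
  have h0 : Fintype.card (Function.fixedPoints t) = 0 := by
    rw [Fintype.card_eq_zero_iff, isEmpty_subtype]
    intro z hz
    have h5 := hfix z hz
    have h1 : t = 1 := by
      rw [show (5 : ℕ) = 2 * 2 + 1 from rfl, pow_succ, pow_mul, h2, one_pow, one_mul] at h5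
      exact h5
    rw [h1] at htp
    exact hpq htp
  rw [Equiv.Perm.sign_of_pow_two_eq_one h2, h0]
  rfl

lemma sign_eq_one_of_pow_five {α : Equiv.Perm (Fin 6)} (h : α ^ 5 = 1) :
    Equiv.Perm.sign α = 1 := by
  have h1 := congrArg Equiv.Perm.sign h
  rw [map_pow, map_one] at h1
  rcases Int.units_eq_one_or (Equiv.Perm.sign α) with h2 | h2
  · exact h2
  · rw [h2] at h1; exact absurd h1 (by decide)

/-- There are no regular embeddings of `H(d,6)` for `d ≥ 3`. The rotations by `d` steps about the
two ends of an edge generate a group that acts on the coordinate of the edge like a sharply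
2-transitive group of degree six; an element swapping the two ends would have to be an odd
permutation, although it is a product of permutations of order five. -/
theorem IsRegular.not_three_le (hM : M.IsRegular) : ¬ 3 ≤ d := by
  intro hd
  obtain ⟨x⟩ := M.nonempty
  obtain ⟨R, α, -, hα, hαfix, hαtrans, -, -⟩ := hM.exists_rotation x
  obtain ⟨S, β, -, hβ, hβfix, hβtrans, -, -⟩ := hM.exists_rotation (M.r0 x)
  rw [dir_r0, nbr_zero, M.r0_invol] at hβtrans
  rw [nbr_zero] at hαtrans
  set i₀ := dir x
  set p := M.vert x i₀
  set q := M.vert (M.r0 x) i₀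
  have hpq : p ≠ q := vert_dir_ne x
  obtain ⟨z, hzp, hzq⟩ : ∃ z : Fin 6, z ≠ p ∧ z ≠ q := by
    generalize p = p; generalize q = q; revert p q; decide
  have hzfix : ∀ {γ : Equiv.Perm (Fin 6)} {y : Fin 6} (k : ℤ), γ y = y → (γ ^ k) y = y :=
    fun k h => Function.IsFixedPt.perm_zpow h k
  obtain ⟨j, hj⟩ := hβtrans z hzq
  obtain ⟨m, hm⟩ := hαtrans z hzp
  set y := (α i₀ ^ (-m)) q with hy
  have hmz : (α i₀ ^ (-m)) z = q := by
    rw [← hm, ← Equiv.Perm.mul_apply, ← zpow_add, neg_add_cancel]; rfl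
  have hyq : y ≠ q := by
    intro h
    exact hzq ((α i₀ ^ (-m)).injective (h.trans hmz.symm)).symm
  obtain ⟨l, hl⟩ := hβtrans y hyq
  -- `t` is the element that swaps `p` and `q`
  set γ : Fin d → Equiv.Perm (Fin 6) := β ^ (-l) * α ^ (-m) * β ^ j with hγ
  have hγi : ∀ k, γ k = β k ^ (-l) * α k ^ (-m) * β k ^ j := fun k => rfl
  have htp : γ i₀ p = q := by
    rw [hγi, Equiv.Perm.mul_apply, Equiv.Perm.mul_apply, hj, hmz]
    exact hzfix _ (hβfix i₀)
  have htq : γ i₀ q = p := by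
    rw [hγi, Equiv.Perm.mul_apply, Equiv.Perm.mul_apply, hzfix _ (hβfix i₀), ← hy, ← hl,
      ← Equiv.Perm.mul_apply, ← zpow_add, neg_add_cancel]
    rfl
  have hoff : ∀ k, k ≠ i₀ → γ k (M.vert x k) = M.vert x k := by
    intro k hk
    have h1 : β k (M.vert x k) = M.vert x k := by
      rw [vert_eq_of_ne_dir x hk]; exact hβfix k
    rw [hγi, Equiv.Perm.mul_apply, Equiv.Perm.mul_apply, hzfix _ h1, hzfix _ (hαfix k),
      hzfix _ h1]
  have hT : vertAut ((S ^ d) ^ (-l) * (R ^ d) ^ (-m) * (S ^ d) ^ j) = coordAut γ := by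
    rw [map_mul, map_mul, map_zpow, map_zpow, map_zpow, hα, hβ, hγ]
    simp only [map_mul, map_zpow]
  set T := (S ^ d) ^ (-l) * (R ^ d) ^ (-m) * (S ^ d) ^ j
  have hpow : ∀ n : ℕ, T ^ n = 1 → γ i₀ ^ n = 1 := by
    intro n h
    have h1 : coordAut (γ ^ n) = coordAut (1 : Fin d → Equiv.Perm (Fin 6)) := by
      rw [map_pow, ← hT, ← map_pow, h, map_one, map_one]
    exact congrFun (coordAut_injective h1) i₀
  have hsign : Equiv.Perm.sign (γ i₀) = -1 := by
    refine sign_eq_neg_one hpq htp htq (hpow 10 ?_) fun z hz => hpow 5 ?_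
    · have : (T ^ 2) ^ 5 = 1 := by
        refine hM.pow_five_eq_one hd (δ := γ ^ 2) (w := M.vert x) (by rw [map_pow, hT, map_pow]) ?_
        intro k
        by_cases hk : k = i₀
        · subst hk
          rw [Pi.pow_apply, pow_two, Equiv.Perm.mul_apply, htp, htq]
        · exact Function.IsFixedPt.perm_pow (e := γ k) (hoff k hk) 2
      rwa [← pow_mul] at this
    · refine hM.pow_five_eq_one hd hT (w := Function.update (M.vert x) i₀ z) ?_
      intro k
      by_cases hk : k = i₀
      · subst hk; simpa using hz
      · simpa [hk] using hoff k hk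
  have hα5 := sign_eq_one_of_pow_five (perm_pow_five hpq.symm (hαfix i₀) hαtrans)
  have hβ5 : Equiv.Perm.sign (β i₀) = 1 := by
    refine sign_eq_one_of_pow_five (perm_pow_five (q := p) hpq (hβfix i₀) hβtrans)
  rw [hγi, map_mul, map_mul, map_zpow, map_zpow, map_zpow, hα5, hβ5] at hsign
  simp at hsign

end Rotation
end GraphMap

/-! ### Regular embeddings of `H(2,6)` -/

/-- The neighbours of the vertex `(0,0)` of `H(2,6)`, in the cyclic order in which the standard
rotation permutes them. -/
def stdNbr : Fin 10 → Fin 2 → Fin 6 :=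
  ![![1, 0], ![0, 1], ![2, 0], ![0, 2], ![3, 0], ![0, 3], ![4, 0], ![0, 4], ![5, 0], ![0, 5]]

/-- The standard rotation about the vertex `(0,0)`. -/
def stdRot : hammingGraph 2 6 ≃g hammingGraph 2 6 :=
  wreathAut ![1, c[1, 2, 3, 4, 5]] (Equiv.swap 0 1)

/-- The two coordinates of the standard reflection at the vertex `(0,0)`. -/
def stdRefl : Fin 2 → Equiv.Perm (Fin 6) :=
  ![Equiv.swap 2 5 * Equiv.swap 3 4, Equiv.swap 1 5 * Equiv.swap 2 4]

lemma stdRot_zero : stdRot 0 = 0 := by decide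

lemma stdRot_stdNbr : ∀ k, stdRot (stdNbr k) = stdNbr (k + 1) := by decide

lemma stdRefl_zero : coordAut stdRefl 0 = 0 := by decide

lemma stdRefl_stdNbr : ∀ k, coordAut stdRefl (stdNbr k) = stdNbr (-k) := by decide

lemma eq_zero_of_stdRot {v : Fin 2 → Fin 6} (h : stdRot v = v) : v = 0 := by
  revert v; decide

lemma exists_stdNbr_eq {w : Fin 2 → Fin 6} (hw : (hammingGraph 2 6).Adj 0 w) :
    ∃ k, w = stdNbr k := by
  obtain ⟨i, z, hz, rfl⟩ := exists_eq_update hw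
  have : ∀ (i : Fin 2) (z : Fin 6), z ≠ 0 →
      ∃ k, Function.update (0 : Fin 2 → Fin 6) i z = stdNbr k := by decide
  exact this i z hz

/-- The involution that commutes with `(2 5)(3 4)`, swaps `0` and `1`, and takes `2` and `3` to the
given values, if it exists. -/
def swapFun (p : Fin 6 × Fin 6) : Fin 6 → Fin 6 :=
  ![1, 0, p.1, p.2, stdRefl 0 p.2, stdRefl 0 p.1]

/-- The involution that commutes with `(1 5)(2 4)`, fixes `0`, and takes `1` and `2` to the given
values, if it exists. -/
def fixFun (q : Fin 6 × Fin 6) : Fin 6 → Fin 6 :=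
  ![0, q.1, q.2, 3, stdRefl 1 q.2, stdRefl 1 q.1]

/-- The effect on `H(2,6)` of a product of edge flips `(f, g)` and powers of the standard rotation;
the word lists the exponents of the rotation, each being followed by a flip. -/
def wordAct (f g : Fin 6 → Fin 6) (w : List ℕ) (v : Fin 6 × Fin 6) : Fin 6 × Fin 6 :=
  w.foldl (fun v e => Prod.map f g ((fun u => (![0, 2, 3, 4, 5, 1] u.2, u.1))^[e] v)) v

/-- The word stabilises `(0,0)` without preserving the cyclic order of its neighbours. -/
def BreaksOrder (f g : Fin 6 → Fin 6) (w : List ℕ) : Prop :=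
  wordAct f g w (0, 0) = (0, 0) ∧ ∀ k : Fin 10,
    wordAct f g w (1, 0) = (stdNbr k 0, stdNbr k 1) →
    wordAct f g w (0, 1) ≠ (stdNbr (k + 1) 0, stdNbr (k + 1) 1) ∧
    wordAct f g w (0, 1) ≠ (stdNbr (k - 1) 0, stdNbr (k - 1) 1)

instance (f g : Fin 6 → Fin 6) (w : List ℕ) : Decidable (BreaksOrder f g w) := by
  unfold BreaksOrder; infer_instance

set_option maxRecDepth 10000 in
/-- Of the `36` possible edge flips, four words exclude all but two. The words come from a computer
search. -/
lemma exists_breaksOrder : ∀ p, (∀ i, swapFun p (swapFun p i) = i) →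
    ∀ q, (∀ i, fixFun q (fixFun q i) = i) →
      (∃ w ∈ [[2, 4, 4, 4, 2, 4, 2], [8, 4, 8, 8, 4], [2, 2, 2, 4, 4, 2, 4], [1, 4, 8, 8]],
        BreaksOrder (swapFun p) (fixFun q) w) ∨
      (p = (5, 3) ∧ q = (2, 1)) ∨ (p = (2, 4) ∧ q = (4, 5)) := by
  decide

namespace GraphMap

variable {M : GraphMap.{u} (hammingGraph 2 6)}

/-- An automorphism `ψ` of `H(2,6)` that takes `(0,0)` and its neighbours, in the standard cyclic
order, to the vertex of the flag `x` and its neighbours in the order of the rotation from `x` on.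
Conjugating by `ψ` gives coordinates adapted to `x`. -/
def IsFrame (x : M.Flag) (ψ : hammingGraph 2 6 ≃g hammingGraph 2 6) : Prop :=
  ψ 0 = M.vert x ∧ ∀ k : Fin 10, ψ (stdNbr k) = M.nbr x (k : ℕ)

lemma IsRegular.nbr_congr (hM : M.IsRegular) (x : M.Flag) {k l : ℤ} (h : k % 10 = l % 10) :
    M.nbr x k = M.nbr x l := by
  obtain ⟨-, -, -, -, -, -, hper, -⟩ := hM.exists_rotation x
  have h10 : ∀ m : ℤ, M.nbr x (l + 10 * m) = M.nbr x l := by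
    intro m
    rw [← nbr_rot_zpow, zpow_mul]
    congr 1
    exact Function.IsFixedPt.perm_zpow (e := M.rot ^ (10 : ℤ)) (by exact_mod_cast hper) m
  rw [← h10 ((k - l) / 10)]
  congr 1
  omega

lemma IsRegular.exists_isFrame (hM : M.IsRegular) (x : M.Flag) : ∃ ψ, IsFrame x ψ := by
  obtain ⟨-, -, -, -, -, -, -, hdir⟩ := hM.exists_rotation x
  let π : Equiv.Perm (Fin 2) := Equiv.swap 0 (dir x)
  have hπ0 : π 0 = dir x := Equiv.swap_apply_left _ _
  have hπ1 : π 1 ≠ dir x := by rw [← hπ0]; exact fun h => absurd (π.injective h) (by decide)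
  -- even neighbours differ from the base vertex in one coordinate, odd ones in the other
  have heven : ∀ k : ℤ, k % 2 = 0 → M.nbr x k (π 1) = M.vert x (π 1) := by
    intro k hk
    apply nbr_eq_of_ne_dir
    rwa [(hdir k).2 (Int.dvd_of_emod_eq_zero hk)]
  have hodd : ∀ k : ℤ, k % 2 = 1 → M.nbr x k (π 0) = M.vert x (π 0) := by
    intro k hk
    apply nbr_eq_of_ne_dir
    rw [hπ0]
    intro h
    have := (hdir k).1 h.symm
    omega
  let f : Fin 2 → Fin 6 → Fin 6 := ![
    ![M.vert x (π 0), M.nbr x 0 (π 0), M.nbr x 2 (π 0), M.nbr x 4 (π 0), M.nbr x 6 (π 0),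
      M.nbr x 8 (π 0)],
    ![M.vert x (π 1), M.nbr x 1 (π 1), M.nbr x 3 (π 1), M.nbr x 5 (π 1), M.nbr x 7 (π 1),
      M.nbr x 9 (π 1)]]
  have hf0 : Function.Surjective (f 0) := by
    intro z
    by_cases hz : z = M.vert x (π 0)
    · exact ⟨0, hz.symm⟩
    obtain ⟨k, hk, hk'⟩ := exists_nbr_eq_update x hz
    have h1 : z = M.nbr x k (π 0) := by rw [hk, Function.update_self]
    have h2 := (hdir k).1 (hk'.trans hπ0)
    have h3 : k % 10 = 0 % 10 ∨ k % 10 = 2 % 10 ∨ k % 10 = 4 % 10 ∨ k % 10 = 6 % 10 ∨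
      k % 10 = 8 % 10 := by omega
    rcases h3 with h | h | h | h | h <;> rw [hM.nbr_congr x h] at h1
    exacts [⟨1, h1.symm⟩, ⟨2, h1.symm⟩, ⟨3, h1.symm⟩, ⟨4, h1.symm⟩, ⟨5, h1.symm⟩]
  have hf1 : Function.Surjective (f 1) := by
    intro z
    by_cases hz : z = M.vert x (π 1)
    · exact ⟨0, hz.symm⟩
    obtain ⟨k, hk, hk'⟩ := exists_nbr_eq_update x hz
    have h1 : z = M.nbr x k (π 1) := by rw [hk, Function.update_self]
    have h2 : ¬ (2 : ℤ) ∣ k := fun h => hπ1 (hk'.symm.trans ((hdir k).2 h))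
    have h3 : k % 10 = 1 % 10 ∨ k % 10 = 3 % 10 ∨ k % 10 = 5 % 10 ∨ k % 10 = 7 % 10 ∨
      k % 10 = 9 % 10 := by omega
    rcases h3 with h | h | h | h | h <;> rw [hM.nbr_congr x h] at h1
    exacts [⟨1, h1.symm⟩, ⟨2, h1.symm⟩, ⟨3, h1.symm⟩, ⟨4, h1.symm⟩, ⟨5, h1.symm⟩]
  let δ : Fin 2 → Equiv.Perm (Fin 6) :=
    ![Equiv.ofBijective _ (Finite.surjective_iff_bijective.1 hf0),
      Equiv.ofBijective _ (Finite.surjective_iff_bijective.1 hf1)]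
  have hext : ∀ v w : Fin 2 → Fin 6, f 0 (v 0) = w (π 0) → f 1 (v 1) = w (π 1) →
      wreathAut δ π v = w := by
    intro v w h0 h1
    ext1 j
    obtain ⟨i, rfl⟩ := π.surjective j
    rw [wreathAut_apply]
    fin_cases i
    · exact h0
    · exact h1
  refine ⟨wreathAut δ π, hext _ _ rfl rfl, fun k => hext _ _ ?_ ?_⟩
  · fin_cases k
    exacts [rfl, (hodd 1 rfl).symm, rfl, (hodd 3 rfl).symm, rfl, (hodd 5 rfl).symm, rfl,
      (hodd 7 rfl).symm, rfl, (hodd 9 rfl).symm]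
  · fin_cases k
    exacts [(heven 0 rfl).symm, rfl, (heven 2 rfl).symm, rfl, (heven 4 rfl).symm, rfl,
      (heven 6 rfl).symm, rfl, (heven 8 rfl).symm, rfl]

section Frame

variable {x : M.Flag} {ψ : hammingGraph 2 6 ≃g hammingGraph 2 6}

/-- An automorphism of the map is determined, in the coordinates of a frame, by its effect on the
cyclic order at the base vertex. -/
lemma IsFrame.vertAut_mul_eq (hψ : IsFrame x ψ) {a : M.autGroup}
    {g : hammingGraph 2 6 ≃g hammingGraph 2 6} {s : Fin 10 → Fin 10}
    (hv : M.vert (a.1 x) = M.vert x) (hs : ∀ k : Fin 10, M.nbr (a.1 x) (k : ℕ) = M.nbr x (s k : ℕ))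
    (hg0 : g 0 = 0) (hg : ∀ k, g (stdNbr k) = stdNbr (s k)) : vertAut a * ψ = ψ * g := by
  refine aut_eq_of_nbrs (by norm_num) (v := 0) ?_ ?_
  · rw [RelIso.mul_apply, RelIso.mul_apply, hg0, hψ.1, vertAut_vert, hv]
  · intro w hw
    obtain ⟨k, rfl⟩ := exists_stdNbr_eq hw
    rw [RelIso.mul_apply, RelIso.mul_apply, hg, hψ.2, hψ.2, vertAut_nbr, hs]

lemma IsFrame.vertAut_rot (hψ : IsFrame x ψ) (hM : M.IsRegular) {a : M.autGroup}
    (ha : a.1 x = M.rot x) : vertAut a * ψ = ψ * stdRot := by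
  refine hψ.vertAut_mul_eq (s := fun k => k + 1) ?_ ?_ stdRot_zero stdRot_stdNbr
  · rw [ha]
    simpa using vert_rot_zpow x 1
  · intro k
    have := nbr_rot_zpow x (k : ℕ) 1
    rw [zpow_one] at this
    rw [ha, this]
    apply hM.nbr_congr
    rw [Fin.val_add]
    norm_num

lemma IsFrame.vertAut_r2 (hψ : IsFrame x ψ) (hM : M.IsRegular) {a : M.autGroup}
    (ha : a.1 x = M.r2 x) : vertAut a * ψ = ψ * coordAut stdRefl := by
  refine hψ.vertAut_mul_eq (s := fun k => -k) ?_ ?_ stdRefl_zero stdRefl_stdNbr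
  · rw [ha, vert_r2]
  · intro k
    rw [ha, nbr_r2]
    apply hM.nbr_congr
    rw [Fin.val_neg']
    omega

/-- The stabiliser of the base vertex preserves the cyclic order of the neighbours up to
reversal. -/
lemma IsFrame.exists_stdNbr (hψ : IsFrame x ψ) (hM : M.IsRegular) {a : M.autGroup}
    {g : hammingGraph 2 6 ≃g hammingGraph 2 6} (ha : vertAut a * ψ = ψ * g) (hg : g 0 = 0) :
    ∃ k : Fin 10, g (stdNbr 0) = stdNbr k ∧
      (g (stdNbr 1) = stdNbr (k + 1) ∨ g (stdNbr 1) = stdNbr (k - 1)) := by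
  have hv : M.vert x = M.vert (a.1 x) := by
    have := DFunLike.congr_fun ha 0
    rw [RelIso.mul_apply, RelIso.mul_apply, hg, hψ.1, vertAut_vert] at this
    exact this.symm
  have hk : ∀ k l : Fin 10, ∀ m : ℤ, M.nbr (a.1 x) (k : ℕ) = M.nbr x m → m % 10 = (l : ℕ) →
      g (stdNbr k) = stdNbr l := by
    intro k l m h hm
    have := DFunLike.congr_fun ha (stdNbr k)
    rw [RelIso.mul_apply, RelIso.mul_apply, hψ.2, vertAut_nbr, h,
      hM.nbr_congr x (l := (l : ℕ)) (by omega), ← hψ.2] at this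
    exact ψ.injective this.symm
  obtain ⟨m, hm⟩ := eq_rot_zpow_of_vert_eq hv
  let k : Fin 10 := ⟨(m % 10).toNat, by omega⟩
  have hkm : ((k : ℕ) : ℤ) = m % 10 := Int.toNat_of_nonneg (by omega)
  have hadd : (((k + 1 : Fin 10) : ℕ) : ℤ) = (m + 1) % 10 := by
    rw [Fin.val_add]; push_cast; omega
  have hsub : (((k - 1 : Fin 10) : ℕ) : ℤ) = (m - 1) % 10 := by
    rw [Fin.sub_def]; push_cast; omega
  refine ⟨k, ?_⟩
  rcases hm with hm | hm
  · refine ⟨hk 0 k m ?_ hkm.symm, Or.inl (hk 1 _ (m + 1) ?_ hadd.symm)⟩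
    · rw [hm, nbr_rot_zpow]; simp
    · rw [hm, nbr_rot_zpow, add_comm]; simp
  · refine ⟨hk 0 k m ?_ hkm.symm, Or.inr (hk 1 _ (m - 1) ?_ hsub.symm)⟩
    · rw [hm, nbr_r2, nbr_rot_zpow]; simp
    · rw [hm, nbr_r2, nbr_rot_zpow, sub_eq_neg_add]; simp

/-- The half-turn about the midpoint of the base edge acts coordinatewise as one of `36` flips. It
keeps the direction of that edge, and hence the other direction as well; that it is an involution
commuting with the reflection at `x` cuts down its two coordinates to six choices each. -/
lemma IsFrame.exists_flip (hψ : IsFrame x ψ) (hM : M.IsRegular) {a : M.autGroup}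
    (ha : a.1 x = M.r0 (M.r2 x)) : ∃ σ : Fin 2 → Equiv.Perm (Fin 6),
      vertAut a * ψ = ψ * coordAut σ ∧
      ∃ p q, ⇑(σ 0) = swapFun p ∧ ⇑(σ 1) = fixFun q ∧ (∀ i, swapFun p (swapFun p i) = i) ∧
        ∀ i, fixFun q (fixFun q i) = i := by
  obtain ⟨δ, π, hδ⟩ := exists_wreathAut_eq (ψ⁻¹ * vertAut a * ψ) (by norm_num)
  have haψ : vertAut a * ψ = ψ * wreathAut δ π := by rw [← hδ]; group
  have h0 : wreathAut δ π 0 = stdNbr 0 := by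
    have := DFunLike.congr_fun haψ 0
    rw [RelIso.mul_apply, RelIso.mul_apply, hψ.1, vertAut_vert, ha, vert_r0_r2, ← nbr_zero] at this
    exact ψ.injective (this.symm.trans (hψ.2 0).symm)
  have h1 : wreathAut δ π (stdNbr 0) = 0 := by
    have := DFunLike.congr_fun haψ (stdNbr 0)
    rw [RelIso.mul_apply, RelIso.mul_apply, hψ.2, vertAut_nbr, ha] at this
    apply ψ.injective
    rw [← this, hψ.1]
    change M.nbr _ 0 = _
    rw [nbr_zero, M.r0_invol, vert_r2]
  have hπ0 : π 0 = 0 := by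
    by_contra hne
    have hπ : π 0 = 1 := by generalize π 0 = j at hne; revert j; decide
    have e0 := wreathAut_apply δ π 0 0
    have e1 := wreathAut_apply δ π (stdNbr 0) 0
    rw [hπ, h0] at e0
    rw [hπ, h1] at e1
    have : (0 : Fin 6) = 1 := (δ 0).injective (e0.symm.trans e1)
    exact absurd this (by decide)
  have hπ : π = 1 := by
    clear hδ haψ h0 h1
    revert π; decide
  subst hπ
  change vertAut a * ψ = ψ * coordAut δ at haψ
  -- the flip is an involution and commutes with the reflection at the base flag
  obtain ⟨t, ht⟩ := hM.exists_aut x (M.r2 x)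
  have htψ := hψ.vertAut_r2 hM ht
  have haa : a * a = 1 := by
    apply hM.aut_ext (x := x)
    change a.1 (a.1 x) = x
    rw [ha, aut_r0, aut_r2, ha, M.r0_r2_comm, M.r0_invol, M.r2_invol]
  have hat : a * t = t * a := by
    apply hM.aut_ext (x := x)
    change a.1 (t.1 x) = t.1 (a.1 x)
    rw [ha, ht, aut_r0, aut_r2, aut_r2, ha, ht, M.r0_r2_comm, M.r0_r2_comm,
      M.r0_r2_comm]
  have hδδ : δ * δ = 1 := by
    apply coordAut_injective
    apply mul_left_cancel (a := ψ)
    rw [map_mul, ← mul_assoc, ← haψ, mul_assoc, ← haψ, ← mul_assoc, ← map_mul, haa]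
    simp
  have hδt : δ * stdRefl = stdRefl * δ := by
    apply coordAut_injective
    apply mul_left_cancel (a := ψ)
    rw [map_mul, map_mul, ← mul_assoc, ← mul_assoc, ← haψ, ← htψ, mul_assoc, mul_assoc, ← haψ,
      ← htψ, ← mul_assoc, ← mul_assoc, ← map_mul, ← map_mul, hat]
  have hinv : ∀ i z, δ i (δ i z) = z := fun i z => DFunLike.congr_fun (congrFun hδδ i) z
  have hcomm : ∀ i z, δ i (stdRefl i z) = stdRefl i (δ i z) :=
    fun i z => DFunLike.congr_fun (congrFun hδt i) z
  have h0' : ∀ i, δ i 0 = stdNbr 0 i := fun i => by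
    rw [← h0]; exact (coordAut_apply δ 0 i).symm
  have h3 : δ 1 3 = 3 := by
    have hfix : stdRefl 1 (δ 1 3) = δ 1 3 := (hcomm 1 3).symm
    have hne : δ 1 3 ≠ 0 := by
      intro h
      have h00 : δ 1 0 = 0 := h0' 1
      have : (3 : Fin 6) = 0 := (δ 1).injective (h.trans h00.symm)
      exact absurd this (by decide)
    have key : ∀ z, stdRefl 1 z = z → z ≠ 0 → z = 3 := by decide
    exact key _ hfix hne
  have e0 : ⇑(δ 0) = swapFun (δ 0 2, δ 0 3) := by
    ext1 i
    fin_cases i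
    · exact h0' 0
    · have h10 : δ 0 0 = 1 := h0' 0
      exact (congrArg (δ 0) h10).symm.trans (hinv 0 0)
    · rfl
    · rfl
    · exact hcomm 0 3
    · exact hcomm 0 2
  have e1 : ⇑(δ 1) = fixFun (δ 1 1, δ 1 2) := by
    ext1 i
    fin_cases i
    · exact h0' 1
    · rfl
    · rfl
    · exact h3
    · exact hcomm 1 2
    · exact hcomm 1 1
  exact ⟨δ, haψ, _, _, e0, e1, fun i => by rw [← e0, hinv], fun i => by rw [← e1, hinv]⟩

/-- Words in the rotation and the flip act on the vertices as automorphisms of the map. -/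
lemma IsFrame.exists_vertAut_word {a b : M.autGroup} {σ : Fin 2 → Equiv.Perm (Fin 6)}
    (ha : vertAut a * ψ = ψ * stdRot) (hb : vertAut b * ψ = ψ * coordAut σ) (w : List ℕ) :
    ∃ (c : M.autGroup) (g : hammingGraph 2 6 ≃g hammingGraph 2 6), vertAut c * ψ = ψ * g ∧
      ∀ v, (g v 0, g v 1) = wordAct (σ 0) (σ 1) w (v 0, v 1) := by
  have hmul : ∀ {a b : M.autGroup} {g h}, vertAut a * ψ = ψ * g → vertAut b * ψ = ψ * h →
      vertAut (a * b) * ψ = ψ * (g * h) := by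
    intro a b g h ha hb
    rw [map_mul, mul_assoc, hb, ← mul_assoc, ha, mul_assoc]
  have hpow : ∀ e : ℕ, ∃ (c : M.autGroup) (g : hammingGraph 2 6 ≃g hammingGraph 2 6),
      vertAut c * ψ = ψ * g ∧ ∀ v, (g v 0, g v 1) =
        (fun u : Fin 6 × Fin 6 => ((![0, 2, 3, 4, 5, 1] : Fin 6 → Fin 6) u.2, u.1))^[e]
          (v 0, v 1) := by
    intro e
    induction e with
    | zero => exact ⟨1, 1, by simp, fun v => rfl⟩
    | succ e ih =>
      obtain ⟨c, g, hc, hg⟩ := ih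
      refine ⟨a * c, stdRot * g, hmul ha hc, fun v => ?_⟩
      rw [Function.iterate_succ_apply', ← hg, RelIso.mul_apply]
      generalize g v = v'
      have : ∀ z : Fin 6, (c[1, 2, 3, 4, 5] : Equiv.Perm (Fin 6)) z
        = (![0, 2, 3, 4, 5, 1] : Fin 6 → Fin 6) z := by decide
      exact Prod.ext (this _) rfl
  induction w using List.reverseRecOn with
  | nil => exact ⟨1, 1, by simp, fun v => rfl⟩
  | append_singleton w e ih =>
    obtain ⟨c, g, hc, hg⟩ := ih
    obtain ⟨c', g', hc', hg'⟩ := hpow e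
    refine ⟨b * (c' * c), coordAut σ * (g' * g), hmul hb (hmul hc' hc), fun v => ?_⟩
    have hstep : wordAct (σ 0) (σ 1) (w ++ [e]) (v 0, v 1) = Prod.map (σ 0) (σ 1)
        ((fun u : Fin 6 × Fin 6 => ((![0, 2, 3, 4, 5, 1] : Fin 6 → Fin 6) u.2, u.1))^[e]
          (wordAct (σ 0) (σ 1) w (v 0, v 1))) := by
      rw [wordAct, List.foldl_append]; rfl
    rw [hstep, ← hg, ← hg']
    rfl

/-- No automorphism of a regular embedding breaks the cyclic order at a vertex. -/
lemma IsFrame.not_breaksOrder (hψ : IsFrame x ψ) (hM : M.IsRegular) {a b : M.autGroup}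
    {σ : Fin 2 → Equiv.Perm (Fin 6)} (ha : vertAut a * ψ = ψ * stdRot)
    (hb : vertAut b * ψ = ψ * coordAut σ) (w : List ℕ) : ¬ BreaksOrder (σ 0) (σ 1) w := by
  rintro ⟨h0, hw⟩
  obtain ⟨c, g, hc, hg⟩ := IsFrame.exists_vertAut_word ha hb w
  have hg0 : g 0 = 0 := by
    have h1 := (hg 0).trans h0
    ext1 i
    fin_cases i
    exacts [congrArg Prod.fst h1, congrArg Prod.snd h1]
  obtain ⟨k, hk, hk'⟩ := hψ.exists_stdNbr hM hc hg0
  have h1 := hw k (by rw [← hk]; exact (hg (stdNbr 0)).symm)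
  rcases hk' with h | h
  · exact h1.1 (by rw [← h]; exact (hg (stdNbr 1)).symm)
  · exact h1.2 (by rw [← h]; exact (hg (stdNbr 1)).symm)

end Frame

/-- Every regular embedding of `H(2,6)` corresponds to one of two pairs of permutations. -/
theorem IsRegular.correspondsTo (hM : M.IsRegular) :
    M.CorrespondsTo (Equiv.swap 0 1 * Equiv.swap 2 5) (Equiv.swap 1 2 * Equiv.swap 4 5) ∨
    M.CorrespondsTo (Equiv.swap 0 1 * Equiv.swap 3 4) (Equiv.swap 1 4 * Equiv.swap 2 5) := by
  obtain ⟨x⟩ := M.nonempty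
  obtain ⟨ψ, hψ⟩ := hM.exists_isFrame x
  obtain ⟨l, hl⟩ := hM.exists_aut x (M.r0 x)
  obtain ⟨r, hr⟩ := hM.exists_aut x (M.r1 x)
  obtain ⟨t, ht⟩ := hM.exists_aut x (M.r2 x)
  have htψ := hψ.vertAut_r2 hM ht
  have htr : vertAut (t * r) * ψ = ψ * stdRot := by
    refine hψ.vertAut_rot hM ?_
    change t.1 (r.1 x) = M.r1 (M.r2 x)
    rw [hr, aut_r1, ht]
  have htl : (t * l).1 x = M.r0 (M.r2 x) := by
    change t.1 (l.1 x) = _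
    rw [hl, aut_r0, ht]
  obtain ⟨σ, hσ, p, q, hp, hq, hpp, hqq⟩ := hψ.exists_flip hM htl
  have hcorr : M.CorrespondsTo (σ 0) (σ 1) := by
    have conj : ∀ {g h : hammingGraph 2 6 ≃g hammingGraph 2 6}, g * ψ = ψ * h →
        ∀ v, ψ.symm (g v) = h (ψ.symm v) := by
      intro g h hgh v
      apply ψ.injective
      have := DFunLike.congr_fun hgh (ψ.symm v)
      simpa using this
    refine ⟨vertAut l, vertAut r, vertAut t, ⟨x, induces_iff.2 ⟨l, hl, rfl⟩,
      induces_iff.2 ⟨r, hr, rfl⟩, induces_iff.2 ⟨t, ht, rfl⟩⟩, ψ.symm, fun v => ⟨?_, ?_, ?_⟩⟩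
    · exact conj htψ v
    · rw [map_mul] at htr
      exact conj htr v
    · rw [map_mul] at hσ
      refine (conj hσ v).trans ?_
      have : σ = ![σ 0, σ 1] := by ext1 i; fin_cases i <;> rfl
      change wreathAct σ 1 _ = _
      rw [← this]
  rcases exists_breaksOrder p hpp q hqq with ⟨w, -, hw⟩ | ⟨rfl, rfl⟩ | ⟨rfl, rfl⟩
  · rw [← hp, ← hq] at hw
    exact absurd hw (hψ.not_breaksOrder hM htr hσ w)
  · left
    convert hcorr using 1 <;> apply DFunLike.coe_injective
    · rw [hp]; decide
    · rw [hq]; decide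
  · right
    convert hcorr using 1 <;> apply DFunLike.coe_injective
    · rw [hp]; decide
    · rw [hq]; decide

/-- The pair of permutations determines a regular embedding of `H(2,6)` up to isomorphism. -/
theorem IsRegular.isIsomorphic {N : GraphMap.{u} (hammingGraph 2 6)} (hM : M.IsRegular)
    (hN : N.IsRegular) {σ₀ σ₁ : Equiv.Perm (Fin 6)} (h : M.CorrespondsTo σ₀ σ₁)
    (h' : N.CorrespondsTo σ₀ σ₁) : M.IsIsomorphic N := by
  obtain ⟨l, r, t, ⟨x, il, ir, it⟩, φ, hφ⟩ := h
  obtain ⟨l', r', t', ⟨x', il', ir', it'⟩, φ', hφ'⟩ := h'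
  obtain ⟨l, hl, rfl⟩ := induces_iff.1 il
  obtain ⟨r, hr, rfl⟩ := induces_iff.1 ir
  obtain ⟨t, ht, rfl⟩ := induces_iff.1 it
  obtain ⟨l', hl', rfl⟩ := induces_iff.1 il'
  obtain ⟨r', hr', rfl⟩ := induces_iff.1 ir'
  obtain ⟨t', ht', rfl⟩ := induces_iff.1 it'
  have conj : ∀ {g h : hammingGraph 2 6 ≃g hammingGraph 2 6}
      {W : (Fin 2 → Fin 6) → Fin 2 → Fin 6}, (∀ v, φ (g v) = W (φ v)) → (∀ v, φ' (h v) = W (φ' v)) →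
      φ'⁻¹ * φ * g = h * (φ'⁻¹ * φ) := by
    intro g h W hg hh
    ext1 v
    apply φ'.injective
    change φ' (φ'.symm (φ (g v))) = φ' (h (φ'.symm (φ v)))
    rw [hh, φ'.apply_symm_apply, φ'.apply_symm_apply, hg]
  have ht2 := conj (fun v => (hφ v).1) (fun v => (hφ' v).1)
  have hr2 := conj (g := vertAut t * vertAut r) (h := vertAut t' * vertAut r')
    (fun v => (hφ v).2.1) (fun v => (hφ' v).2.1)
  have hl2 := conj (g := vertAut t * vertAut l) (h := vertAut t' * vertAut l')
    (fun v => (hφ v).2.2) (fun v => (hφ' v).2.2)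
  rw [← mul_assoc, ht2, mul_assoc, mul_assoc (vertAut t')] at hr2 hl2
  -- the base vertex is the only one that the standard rotation fixes
  have hx : φ (M.vert x) = 0 := by
    apply eq_zero_of_stdRot
    refine ((hφ _).2.1.symm.trans ?_)
    rw [vertAut_vert, vertAut_vert, hr, aut_r1, ht, vert_r1, vert_r2]
  have hx' : φ' (N.vert x') = 0 := by
    apply eq_zero_of_stdRot
    refine ((hφ' _).2.1.symm.trans ?_)
    rw [vertAut_vert, vertAut_vert, hr', aut_r1, ht', vert_r1, vert_r2]
  refine hM.isIsomorphic_of_conj hN rot_rot_ne rot_rot_ne (φ'⁻¹ * φ) (x := x) (x' := x') ?_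
    hl hr ht hl' hr' ht' (mul_left_cancel hl2) (mul_left_cancel hr2) ht2
  apply φ'.injective
  rw [hx']
  change φ' (φ'.symm (φ (M.vert x))) = 0
  rw [φ'.apply_symm_apply, hx]

end GraphMap

theorem lemma3p4 :
    -- no nonorientable regular embedding of `H(d,6)` for `d ≥ 3`
    (∀ d : ℕ, 3 ≤ d →
      ¬ ∃ M : GraphMap.{u} (hammingGraph d 6), M.IsNonorientableRegular) ∧
    -- at most two nonorientable regular embeddings of `H(2,6)`, up to isomorphism
    (∀ M₁ M₂ M₃ : GraphMap.{u} (hammingGraph 2 6), M₁.IsNonorientableRegular →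
      M₂.IsNonorientableRegular → M₃.IsNonorientableRegular →
      M₁.IsIsomorphic M₂ ∨ M₁.IsIsomorphic M₃ ∨ M₂.IsIsomorphic M₃) ∧
    -- each of them corresponds to one of the two pairs `(σ₀, σ₁)`
    (∀ M : GraphMap.{u} (hammingGraph 2 6), M.IsNonorientableRegular →
      M.CorrespondsTo (Equiv.swap 0 1 * Equiv.swap 2 5) (Equiv.swap 1 2 * Equiv.swap 4 5) ∨
      M.CorrespondsTo (Equiv.swap 0 1 * Equiv.swap 3 4) (Equiv.swap 1 4 * Equiv.swap 2 5)) ∧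
    -- and the pair determines the embedding up to isomorphism
    (∀ (σ₀ σ₁ : Equiv.Perm (Fin 6)) (M N : GraphMap.{u} (hammingGraph 2 6)),
      M.IsNonorientableRegular → N.IsNonorientableRegular →
      M.CorrespondsTo σ₀ σ₁ → N.CorrespondsTo σ₀ σ₁ → M.IsIsomorphic N) := by
  refine ⟨fun d hd ⟨M, hM, _⟩ => hM.not_three_le hd, ?_, fun M hM => hM.1.correspondsTo,
    fun σ₀ σ₁ M N hM hN => hM.1.isIsomorphic hN.1⟩
  intro M₁ M₂ M₃ h₁ h₂ h₃
  rcases h₁.1.correspondsTo with c₁ | c₁ <;> rcases h₂.1.correspondsTo with c₂ | c₂ <;>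
  rcases h₃.1.correspondsTo with c₃ | c₃
  all_goals first
    | exact Or.inl (h₁.1.isIsomorphic h₂.1 c₁ c₂)
    | exact Or.inr (Or.inl (h₁.1.isIsomorphic h₃.1 c₁ c₃))
    | exact Or.inr (Or.inr (h₂.1.isIsomorphic h₃.1 c₂ c₃))
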